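/- Let $D$ be the flat connection of $\mathbb R^4$ and $[\cdot,\cdot,\cdot,\cdot]$ the determinant of four vectors. A hyperquadric is the zero set of a real polynomial of degree two in four variables. An immersed (hyper)surface is locally strictly convex if at each of its points some hyperplane locally supports it and has a non-degenerate (Morse type) contact with it. The Blaschke metric of a locally strictly convex immersed hypersurface $N\subset\mathbb R^4$ is $$\mathfrak G(Y,Z)=\frac{H_{\mathfrak u}(Y,Z)}{\bigl(\det (H_{\mathfrak u}(X_i,X_j))\bigr)^{1/5}},\qquad H_{\mathfrak u}(Y,Z)=[X_1,X_2,X_3,D_ZY],$$ where $\mathfrak u=\{X_1,X_2,X_3\}$ is any tangent frame of $N$ (the result does not depend on it) and the fifth root is the real one. Let $M\subset\mathbb R^4$ be an immersed surface with a Riemannian metric $g$. A transversal plane bundle $\sigma$ on $M$ is a smooth field of planes with $\mathbb R^4=T_pM\oplus\sigma_p$ for all $p\in M$; it induces a connection $\nabla=\nabla(\sigma)$, where $\nabla_XY$ is the tangent component of $D_XY$. Write $(\nabla g)(X,Y,Z)=X(g(Y,Z))-g(\nabla_XY,Z)-g(Y,\nabla_XZ)$, and let $\omega_g$ be the metric area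 form of $g$ (defined locally, up to sign). The bundle $\sigma$ is equiaffine with respect to $g$ if $\nabla\omega_g=0$. An equiaffine bundle $\sigma$ is symmetric if, for $g$-orthonormal tangent frames $\{X_1,X_2\}$, $$(\nabla g)(X_2,X_1,X_1)-(\nabla g)(X_1,X_2,X_1)=0,\qquad (\nabla g)(X_1,X_2,X_2)-(\nabla g)(X_2,X_1,X_2)=0,$$ and antisymmetric if $$(\nabla g)(X_2,X_1,X_1)+(\nabla g)(X_1,X_2,X_1)=0,\qquad (\nabla g)(X_1,X_2,X_2)+(\nabla g)(X_2,X_1,X_2)=0.$$ A point $p\in M$ is an inflection if there is a non-zero linear form $\lambda$ on $\mathbb R^4$ that vanishes on $T_pM$ and satisfies $\lambda(D_XY)=0$ at $p$ for all tangent fields $X,Y$ of $M$. **Corollary.** Let $N$ be a smooth locally strictly convex immersed hypersurface of $\mathbb R^4$ contained in a hyperquadric, let $M$ be a smooth surface immersed in $N$, and let $g=\mathfrak G|_M$ be the restriction to $M$ of the Blaschke metric of $N$. Then there is a transversal plane bundle $\sigma$ on $M$ that is at once an antisymmetric and a symmetric equiaffine plane bundle with respect to $g$. Moreover, every antisymmetric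 and every symmetric equiaffine plane bundle $\tau$ on $M$ with respect to $g$ satisfies $\tau_p=\sigma_p$ at each point $p\in M$ that is not an inflection. In particular, if $M$ has no inflections, then the antisymmetric equiaffine plane bundle of $M$ and the symmetric equiaffine plane bundle of $M$ each exist, are unique, and are equal. -/

import Mathlib

open Filter Topology Manifold ContDiff

/-- Real Euclidean space of dimension `n`. -/
abbrev RealSpace (n : ℕ) : Type := EuclideanSpace ℝ (Fin n)

/-- The determinant `[a, b, c, d]` of four vectors of `ℝ⁴`. -/
noncomputable def bracket (a b c d : RealSpace 4) : ℝ :=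
  Matrix.det (Matrix.of fun i j : Fin 4 => (![a, b, c, d] i) j)

/-- The real fifth root, an odd function (`Real.rpow` would not do at negative numbers). -/
noncomputable def fifthRoot (t : ℝ) : ℝ := Real.sign t * |t| ^ ((1 : ℝ) / 5)

/-- A hyperquadric of `ℝ⁴`: the zero set of a polynomial of degree two in four variables. -/
def IsHyperquadric (S : Set (RealSpace 4)) : Prop :=
  ∃ F : MvPolynomial (Fin 4) ℝ, F.totalDegree = 2 ∧
    S = {x | MvPolynomial.eval (fun i => x i) F = 0}

section Immersed

variable (n : ℕ) {P : Type*} [TopologicalSpace P] [ChartedSpace (RealSpace n) P]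

/-- The differential of a map `φ : P → ℝ⁴` at `p`, with values in `ℝ⁴`. -/
noncomputable def diffAt (φ : P → RealSpace 4) (p : P) :
    TangentSpace (𝓡 n) p →L[ℝ] RealSpace 4 :=
  mfderiv (𝓡 n) 𝓘(ℝ, RealSpace 4) φ p

/-- `φ` is a smooth immersion into `ℝ⁴`. -/
def IsSmoothImmersion (φ : P → RealSpace 4) : Prop :=
  ContMDiff (𝓡 n) 𝓘(ℝ, RealSpace 4) ∞ φ ∧
    ∀ p : P, Function.Injective (diffAt n φ p)

/-- `D_z Y` at `p` for the immersion `φ`, where `D` is the flat connection of `ℝ⁴` and `Y` is the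
field that extends the tangent vector `y` with constant coordinates in the preferred chart at `p`
(the chart through which Mathlib identifies the tangent space at `p` with `ℝⁿ`). Its class
modulo the image of the differential, the only thing used below, does not depend on the way in
which `y` is extended. -/
noncomputable def secondDerivAt (φ : P → RealSpace 4) (p : P)
    (z y : TangentSpace (𝓡 n) p) : RealSpace 4 :=
  fderiv ℝ
    (fun w : RealSpace n => fderiv ℝ (φ ∘ (extChartAt (𝓡 n) p).symm) w (y : RealSpace n))
    (extChartAt (𝓡 n) p p) (z : RealSpace n)

/-- Local strict convexity at `p`: some hyperplane `{x | l x = l (φ p)}` supports the immersion near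
`p`, and its contact with the immersion at `p` is non-degenerate (of Morse type). -/
def IsLocallyStrictlyConvexAt (φ : P → RealSpace 4) (p : P) : Prop :=
  ∃ l : RealSpace 4 →L[ℝ] ℝ, l ≠ 0 ∧ (∀ᶠ q in 𝓝 p, l (φ p) ≤ l (φ q)) ∧
    ∀ y : TangentSpace (𝓡 n) p,
      (∀ z : TangentSpace (𝓡 n) p, l (secondDerivAt n φ p z y) = 0) → y = 0

/-- `p` is an inflection: some non-zero conormal, that is, a non-zero linear form that vanishes on
the tangent plane, has a vanishing second fundamental form. -/
def IsInflection (φ : P → RealSpace 4) (p : P) : Prop :=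
  ∃ l : RealSpace 4 →L[ℝ] ℝ, l ≠ 0 ∧ (∀ y : TangentSpace (𝓡 n) p, l (diffAt n φ p y) = 0) ∧
    ∀ y z : TangentSpace (𝓡 n) p, l (secondDerivAt n φ p z y) = 0

variable {n} [IsManifold (𝓡 n) ∞ P]

/-- The vector field `Y` is smooth at `p`. -/
def IsSmoothFieldAt (Y : (q : P) → TangentSpace (𝓡 n) q) (p : P) : Prop :=
  ContMDiffAt (𝓡 n) (𝓡 n).tangent ∞ (fun q => (⟨q, Y q⟩ : TangentBundle (𝓡 n) P)) p

end Immersed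

section Hypersurface

variable {N : Type*} [TopologicalSpace N] [ChartedSpace (RealSpace 3) N]

/-- The form `H_u (y, z) = [u₀, u₁, u₂, D_z Y]` of an immersed hypersurface with respect to a
frame `u` of the tangent space at `x`. -/
noncomputable def hypersurfaceForm (ι : N → RealSpace 4) (x : N)
    (u : Fin 3 → TangentSpace (𝓡 3) x) (y z : TangentSpace (𝓡 3) x) : ℝ :=
  bracket (diffAt 3 ι x (u 0)) (diffAt 3 ι x (u 1)) (diffAt 3 ι x (u 2)) (secondDerivAt 3 ι x z y)

/-- The normalization `H_u (y, z) / (det (H_u (u_i, u_j))) ^ (1/5)`. -/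
noncomputable def normalizedForm (ι : N → RealSpace 4) (x : N)
    (u : Fin 3 → TangentSpace (𝓡 3) x) (y z : TangentSpace (𝓡 3) x) : ℝ :=
  hypersurfaceForm ι x u y z /
    fifthRoot (Matrix.det (Matrix.of fun i j : Fin 3 => hypersurfaceForm ι x u (u i) (u j)))

/-- The coordinate frame of the tangent space at `x`, in the preferred chart at `x`. -/
noncomputable def coordFrame (x : N) : Fin 3 → TangentSpace (𝓡 3) x :=
  fun i => (EuclideanSpace.single i (1 : ℝ) : RealSpace 3)

/-- The Blaschke metric of an immersed hypersurface. The normalized form is the same for every frame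
of the tangent space, so that the coordinate frame may be used. -/
noncomputable def blaschkeMetric (ι : N → RealSpace 4) (x : N)
    (y z : TangentSpace (𝓡 3) x) : ℝ :=
  normalizedForm ι x (coordFrame x) y z

end Hypersurface

section Surface

variable {M : Type*} [TopologicalSpace M] [ChartedSpace (RealSpace 2) M]

/-- The restriction to a surface, mapped by `j` into the hypersurface `ι`, of the Blaschke metric of
the hypersurface. -/
noncomputable def restrictedBlaschke {N : Type*} [TopologicalSpace N]
    [ChartedSpace (RealSpace 3) N] (ι : N → RealSpace 4) (j : M → N) (p : M)
    (y z : TangentSpace (𝓡 2) p) : ℝ :=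
  blaschkeMetric ι (j p) (mfderiv (𝓡 2) (𝓡 3) j p y) (mfderiv (𝓡 2) (𝓡 3) j p z)

/-- A smooth transversal plane bundle `σ` of a surface `f : M → ℝ⁴`:
`ℝ⁴ = T_p M ⊕ σ_p` at each point. -/
@[ext]
structure TransversalPlaneBundle (f : M → RealSpace 4) where
  /-- The plane `σ_p`. -/
  plane : M → Submodule ℝ (RealSpace 4)
  isCompl : ∀ p, IsCompl (LinearMap.range (diffAt 2 f p).toLinearMap) (plane p)
  smooth : ∀ p, ∃ ξ₁ ξ₂ : M → RealSpace 4,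
    ContMDiffAt (𝓡 2) 𝓘(ℝ, RealSpace 4) ∞ ξ₁ p ∧
    ContMDiffAt (𝓡 2) 𝓘(ℝ, RealSpace 4) ∞ ξ₂ p ∧
    ∀ᶠ q in 𝓝 p, plane q = Submodule.span ℝ {ξ₁ q, ξ₂ q}

namespace TransversalPlaneBundle

variable {f : M → RealSpace 4} (σ : TransversalPlaneBundle f)

theorem exists_tangentPart (p : M) (w : RealSpace 4) :
    ∃ t : TangentSpace (𝓡 2) p, w - diffAt 2 f p t ∈ σ.plane p := by
  have h : w ∈ LinearMap.range (diffAt 2 f p).toLinearMap ⊔ σ.plane p := by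
    rw [(σ.isCompl p).sup_eq_top]; trivial
  obtain ⟨a, ⟨t, rfl⟩, b, hb, rfl⟩ := Submodule.mem_sup.mp h
  exact ⟨t, by simpa using hb⟩

/-- The tangent component `t` of `w = df(t) + (element of σ_p)`. It is unique when `f` is an
immersion. -/
noncomputable def tangentPart (p : M) (w : RealSpace 4) : TangentSpace (𝓡 2) p :=
  Classical.choose (σ.exists_tangentPart p w)

/-- The connection `∇ = ∇(σ)` induced by `σ`: `∇_x Y` is the tangent component at `p` of the
derivative `D_x Y` of the field `Y`, seen as a field of vectors of `ℝ⁴` along the surface. -/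
noncomputable def connection (Y : (q : M) → TangentSpace (𝓡 2) q) (p : M)
    (x : TangentSpace (𝓡 2) p) : TangentSpace (𝓡 2) p :=
  σ.tangentPart p (diffAt 2 (fun q => diffAt 2 f q (Y q)) p x)

end TransversalPlaneBundle

/-- The derivative of a real function on the surface along a tangent vector. -/
noncomputable def dirDeriv (u : M → ℝ) (p : M) (x : TangentSpace (𝓡 2) p) : ℝ :=
  mfderiv (𝓡 2) 𝓘(ℝ, ℝ) u p x

/-- `(∇g)(x, Y, Z) = x(g(Y, Z)) - g(∇_x Y, Z) - g(Y, ∇_x Z)` at `p`, for vector fields `Y`, `Z`. -/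
noncomputable def nablaMetric {f : M → RealSpace 4}
    (g : (q : M) → TangentSpace (𝓡 2) q → TangentSpace (𝓡 2) q → ℝ)
    (σ : TransversalPlaneBundle f) (p : M) (x : TangentSpace (𝓡 2) p)
    (Y Z : (q : M) → TangentSpace (𝓡 2) q) : ℝ :=
  dirDeriv (fun q => g q (Y q) (Z q)) p x
    - g p (σ.connection Y p x) (Z p) - g p (Y p) (σ.connection Z p x)

/-- The metric volume form `ω_g` at `q`, for the orientation given by the basis `(a, b)` of the
tangent plane. It is the alternating form whose value at `(a, b)` is the square root of
`g(a, a) g(b, b) - g(a, b) ^ 2`; its value at `(y, z)` is the square root of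
`g(y, y) g(z, z) - g(y, z) ^ 2` for each basis `(y, z)` of the same orientation. -/
noncomputable def metricVolume {q : M}
    (g : TangentSpace (𝓡 2) q → TangentSpace (𝓡 2) q → ℝ)
    (a b y z : TangentSpace (𝓡 2) q) : ℝ :=
  (g a y * g b z - g a z * g b y) / √(g a a * g b b - g a b ^ 2)

/-- `(∇ω_g)(x, Y, Z) = x(ω_g(Y, Z)) - ω_g(∇_x Y, Z) - ω_g(Y, ∇_x Z)` at `p`, for vector fields
`Y`, `Z`, where the orientation near `p` is that of the local frame `(A, B)`. -/
noncomputable def nablaVolume {f : M → RealSpace 4}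
    (g : (q : M) → TangentSpace (𝓡 2) q → TangentSpace (𝓡 2) q → ℝ)
    (σ : TransversalPlaneBundle f) (A B : (q : M) → TangentSpace (𝓡 2) q)
    (p : M) (x : TangentSpace (𝓡 2) p) (Y Z : (q : M) → TangentSpace (𝓡 2) q) : ℝ :=
  dirDeriv (fun q => metricVolume (g q) (A q) (B q) (Y q) (Z q)) p x
    - metricVolume (g p) (A p) (B p) (σ.connection Y p x) (Z p)
    - metricVolume (g p) (A p) (B p) (Y p) (σ.connection Z p x)

variable [IsManifold (𝓡 2) ∞ M]

/-- `σ` is equiaffine with respect to the metric `g`: `∇ω_g = 0`. -/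
def IsEquiaffine {f : M → RealSpace 4}
    (g : (q : M) → TangentSpace (𝓡 2) q → TangentSpace (𝓡 2) q → ℝ)
    (σ : TransversalPlaneBundle f) : Prop :=
  ∀ (p : M) (A B : (q : M) → TangentSpace (𝓡 2) q),
    IsSmoothFieldAt A p → IsSmoothFieldAt B p → LinearIndependent ℝ ![A p, B p] →
    ∀ (x : TangentSpace (𝓡 2) p) (Y Z : (q : M) → TangentSpace (𝓡 2) q),
      IsSmoothFieldAt Y p → IsSmoothFieldAt Z p → nablaVolume g σ A B p x Y Z = 0

/-- `X₁`, `X₂` are vector fields, smooth at `p` and orthonormal at `p` for `g`. As `∇g` is a tensor, it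
does not matter below whether they are orthonormal near `p` or only at `p`. -/
def IsOrthonormalAt
    (g : (q : M) → TangentSpace (𝓡 2) q → TangentSpace (𝓡 2) q → ℝ)
    (X₁ X₂ : (q : M) → TangentSpace (𝓡 2) q) (p : M) : Prop :=
  IsSmoothFieldAt X₁ p ∧ IsSmoothFieldAt X₂ p ∧
    g p (X₁ p) (X₁ p) = 1 ∧ g p (X₁ p) (X₂ p) = 0 ∧ g p (X₂ p) (X₂ p) = 1

/-- `σ` is a symmetric equiaffine plane bundle with respect to the metric `g`. -/
def IsSymmetricEquiaffine {f : M → RealSpace 4}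
    (g : (q : M) → TangentSpace (𝓡 2) q → TangentSpace (𝓡 2) q → ℝ)
    (σ : TransversalPlaneBundle f) : Prop :=
  IsEquiaffine g σ ∧
    ∀ (p : M) (X₁ X₂ : (q : M) → TangentSpace (𝓡 2) q), IsOrthonormalAt g X₁ X₂ p →
      nablaMetric g σ p (X₂ p) X₁ X₁ - nablaMetric g σ p (X₁ p) X₂ X₁ = 0 ∧
      nablaMetric g σ p (X₁ p) X₂ X₂ - nablaMetric g σ p (X₂ p) X₁ X₂ = 0

/-- `σ` is an antisymmetric equiaffine plane bundle with respect to the metric `g`. -/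
def IsAntisymmetricEquiaffine {f : M → RealSpace 4}
    (g : (q : M) → TangentSpace (𝓡 2) q → TangentSpace (𝓡 2) q → ℝ)
    (σ : TransversalPlaneBundle f) : Prop :=
  IsEquiaffine g σ ∧
    ∀ (p : M) (X₁ X₂ : (q : M) → TangentSpace (𝓡 2) q), IsOrthonormalAt g X₁ X₂ p →
      nablaMetric g σ p (X₂ p) X₁ X₁ + nablaMetric g σ p (X₁ p) X₂ X₁ = 0 ∧
      nablaMetric g σ p (X₁ p) X₂ X₂ + nablaMetric g σ p (X₂ p) X₁ X₂ = 0

end Surface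

/-!
The Blaschke metric of `N` is, up to a constant factor, the Hessian of the quadric, and the transversal
bundle of the theorem is the orthogonal complement of the tangent planes of `M` for that Hessian.

Write the quadric as `β (x, x) / 2 + b x + c = 0`. Differentiating this equation twice along a map into
the quadric shows that the gradient `β x + b` is a conormal, and that it turns the second fundamental
form into `-β` (`LiesOnQuadric.gradient_diffAt`, `LiesOnQuadric.gradient_secondDerivAt`). On the
hypersurface `N` the gradient does not vanish: at a singular point the quadric would be a pair of
hyperplanes, which strict convexity excludes (`LiesOnQuadric.gradient_ne_zero`). Hence the conormal
`[u₀, u₁, u₂, ·]` of a frame is `k` times the gradient, the form `H_u` is `-k β`, and the Gram determinant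
of the frame for `β` is the value of the adjugate form of `β` on the conormal, that is `k ^ 2` times its
value on the gradient. The latter is constant on the quadric (`gradient_adjugate_gradient`), so that the
powers of `k` cancel in the Blaschke metric and leave a constant multiple `β'` of `β`
(`LiesOnQuadric.blaschkeMetric_eq`). Convexity makes `β'` positive definite on the tangent spaces
(`LiesOnQuadric.scaled_hessian_pos`).

On `M` the metric `g` is therefore the restriction of the constant form `β'` of `ℝ⁴`. For
`σ_p = (T_p M)^⊥` with respect to `β'` the induced connection is metric, `∇g = 0`
(`nablaMetric_orthogonalBundle`), which gives the equiaffine, the symmetric and the antisymmetric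
conditions at once.

For another bundle `τ`, let `K w = β' (π w, ·)` on `T_p M`, where `π` is the projection onto `τ_p` along
`T_p M`. In an orthonormal frame `a`, `b` the equiaffine condition and one of the two symmetries leave two
free components `u`, `v` of the forms `K (D_x y)`. If they are not both zero, then `K` has null space
`T_p M`, and it annihilates a combination `r D_a a + s D_a b + t D_b b` with `r + t ≠ 0`; but the gradient
takes a non-zero multiple of `r + t` on this vector, while it vanishes on `T_p M`. So `K` annihilates all
`D_x y`. Off the inflections these vectors and the tangent plane span `ℝ⁴`; then `K = 0`, and `τ_p` is
orthogonal to `T_p M` (`plane_eq_orthogonalPlane`).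
-/

/-! ### Immersions and vector fields in charts -/

section Chart

variable {n : ℕ} {P : Type*} [TopologicalSpace P] [ChartedSpace (RealSpace n) P]

theorem diffAt_eq_fderiv {φ : P → RealSpace 4} {p : P}
    (h : MDifferentiableAt (𝓡 n) 𝓘(ℝ, RealSpace 4) φ p) :
    diffAt n φ p = fderiv ℝ (φ ∘ (extChartAt (𝓡 n) p).symm) (extChartAt (𝓡 n) p p) := by
  unfold diffAt
  rw [h.mfderiv]
  simp [writtenInExtChartAt]
  rfl

theorem contDiffAt_comp_extChartAt_symm {φ : P → RealSpace 4} {p : P}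
    (h : ContMDiffAt (𝓡 n) 𝓘(ℝ, RealSpace 4) ∞ φ p) :
    ContDiffAt ℝ ∞ (φ ∘ (extChartAt (𝓡 n) p).symm) (extChartAt (𝓡 n) p p) := by
  have := (contMDiffAt_iff.1 h).2
  rw [ModelWithCorners.range_eq_univ, contDiffWithinAt_univ] at this
  exact this

theorem fderiv_clm_apply_const {E F G : Type*} [NormedAddCommGroup E] [NormedSpace ℝ E]
    [NormedAddCommGroup F] [NormedSpace ℝ F] [NormedAddCommGroup G] [NormedSpace ℝ G]
    {A : E → F →L[ℝ] G} {w : E} (hA : DifferentiableAt ℝ A w) (y : F) :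
    fderiv ℝ (fun v => A v y) w = (fderiv ℝ A w).flip y := by
  rw [(hA.hasFDerivAt.clm_apply (hasFDerivAt_const y w)).fderiv]
  simp

theorem secondDerivAt_eq {φ : P → RealSpace 4} {p : P}
    (h : ContMDiffAt (𝓡 n) 𝓘(ℝ, RealSpace 4) ∞ φ p) (z y : TangentSpace (𝓡 n) p) :
    secondDerivAt n φ p z y =
      fderiv ℝ (fderiv ℝ (φ ∘ (extChartAt (𝓡 n) p).symm)) (extChartAt (𝓡 n) p p) z y := by
  have h1 := contDiffAt_comp_extChartAt_symm h
  have h2 : DifferentiableAt ℝ (fderiv ℝ (φ ∘ (extChartAt (𝓡 n) p).symm))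
      (extChartAt (𝓡 n) p p) :=
    (h1.fderiv_right (m := 1) (by norm_cast)).differentiableAt (by norm_num)
  exact congrArg (fun L : RealSpace n →L[ℝ] RealSpace 4 => L (z : RealSpace n))
    (fderiv_clm_apply_const h2 (y : RealSpace n))

theorem secondDerivAt_comm {φ : P → RealSpace 4} {p : P}
    (h : ContMDiffAt (𝓡 n) 𝓘(ℝ, RealSpace 4) ∞ φ p) (z y : TangentSpace (𝓡 n) p) :
    secondDerivAt n φ p z y = secondDerivAt n φ p y z := by
  rw [secondDerivAt_eq h, secondDerivAt_eq h]
  exact (contDiffAt_comp_extChartAt_symm h).isSymmSndFDerivAt (by simp; norm_cast) z y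

variable [IsManifold (𝓡 n) ∞ P]

theorem contMDiffAt_pushforward {φ : P → RealSpace 4}
    (h : ContMDiff (𝓡 n) 𝓘(ℝ, RealSpace 4) ∞ φ) {p : P} {Y : (q : P) → TangentSpace (𝓡 n) q}
    (hY : IsSmoothFieldAt Y p) :
    ContMDiffAt (𝓡 n) 𝓘(ℝ, RealSpace 4) ∞ (fun q => diffAt n φ q (Y q)) p := by
  have h1 : ContMDiff (𝓡 n).tangent 𝓘(ℝ, RealSpace 4).tangent ∞
      (tangentMap (𝓡 n) 𝓘(ℝ, RealSpace 4) φ) := h.contMDiff_tangentMap (by norm_cast)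
  have h2 := contMDiff_snd_tangentBundle_modelSpace (n := ∞) (RealSpace 4) 𝓘(ℝ, RealSpace 4)
  have hY' : ContMDiffAt (𝓡 n) (𝓡 n).tangent ∞
    (fun q => (⟨q, Y q⟩ : TangentBundle (𝓡 n) P)) p := hY
  exact (h2.comp h1).contMDiffAt.comp p hY'

/-- The field that extends a tangent vector with constant coordinates in the chart at its base
point. -/
noncomputable abbrev constField {p : P} (y : TangentSpace (𝓡 n) p) (q : P) :
    TangentSpace (𝓡 n) q :=
  FiberBundle.extend (RealSpace n) y q

theorem isSmoothFieldAt_constField {p : P} (y : TangentSpace (𝓡 n) p) :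
    IsSmoothFieldAt (constField y) p :=
  FiberBundle.contMDiffAt_extend (𝓡 n) (RealSpace n) y

/-- In the chart at `p`, the field of constant coordinates `y` is pushed forward to the derivative of
`φ` in the direction `y`. -/
theorem pushforward_constField {φ : P → RealSpace 4}
    (h : ContMDiff (𝓡 n) 𝓘(ℝ, RealSpace 4) ∞ φ) {p : P} (y : TangentSpace (𝓡 n) p) {q : P}
    (hq : q ∈ (extChartAt (𝓡 n) p).source) :
    diffAt n φ q (constField y q) =
      fderiv ℝ (φ ∘ (extChartAt (𝓡 n) p).symm) (extChartAt (𝓡 n) p q) (y : RealSpace n) := by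
  have hq' : q ∈ (chartAt (RealSpace n) p).source := by simpa using hq
  have hp' : p ∈ (chartAt (RealSpace n) p).source := mem_chart_source _ p
  have h1 : (constField y q : TangentSpace (𝓡 n) q) =
      mfderivWithin 𝓘(ℝ, RealSpace n) (𝓡 n) (extChartAt (𝓡 n) p).symm (Set.range (𝓡 n))
        (extChartAt (𝓡 n) p q) y := by
    rw [← TangentBundle.symmL_trivializationAt hq']
    have h2 : ((trivializationAt (RealSpace n) (TangentSpace (𝓡 n)) p) ⟨p, y⟩).2 = y := by
      have h3 := TangentBundle.continuousLinearMapAt_trivializationAt (I := 𝓡 n) hp'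
      rw [mfderiv_extChartAt_self] at h3
      have h4 := congrArg (fun L => L y) h3
      rw [Bundle.Trivialization.continuousLinearMapAt_apply,
        Bundle.Trivialization.coe_linearMapAt_of_mem] at h4
      · exact h4
      · simp
    have h3 := congrArg ((trivializationAt (RealSpace n) (TangentSpace (𝓡 n)) p).symm q) h2
    exact h3.trans (Bundle.Trivialization.symmL_apply
      (trivializationAt (RealSpace n) (TangentSpace (𝓡 n)) p) (by simpa using hq') y).symm
  have hq2 : extChartAt (𝓡 n) p q ∈ (extChartAt (𝓡 n) p).target :=
    (extChartAt (𝓡 n) p).map_source hq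
  have h5 := mfderiv_comp_mfderivWithin_of_eq (I := 𝓘(ℝ, RealSpace n)) (I' := 𝓡 n)
    (I'' := 𝓘(ℝ, RealSpace 4)) (g := φ) (f := (extChartAt (𝓡 n) p).symm)
    (s := Set.range (𝓡 n)) (x := extChartAt (𝓡 n) p q) (y := q)
    (h.mdifferentiableAt (by simp)) (mdifferentiableWithinAt_extChartAt_symm hq2)
    (by rw [ModelWithCorners.range_eq_univ]; exact uniqueMDiffWithinAt_univ _)
    ((extChartAt (𝓡 n) p).left_inv hq)
  rw [h1]
  unfold diffAt
  have h6 := congrArg (fun L => L y) h5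
  rw [ModelWithCorners.range_eq_univ, mfderivWithin_univ, mfderiv_eq_fderiv] at h6
  rw [ModelWithCorners.range_eq_univ]
  exact h6.symm

theorem diffAt_pushforward_constField {φ : P → RealSpace 4}
    (h : ContMDiff (𝓡 n) 𝓘(ℝ, RealSpace 4) ∞ φ) {p : P} (x y : TangentSpace (𝓡 n) p) :
    diffAt n (fun q => diffAt n φ q (constField y q)) p x = secondDerivAt n φ p x y := by
  rw [diffAt_eq_fderiv ((contMDiffAt_pushforward h
    (isSmoothFieldAt_constField y)).mdifferentiableAt (by simp))]
  unfold secondDerivAt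
  refine congrArg (fun L : RealSpace n →L[ℝ] RealSpace 4 => L (x : RealSpace n))
    (Filter.EventuallyEq.fderiv_eq ?_)
  filter_upwards [extChartAt_target_mem_nhds (I := 𝓡 n) p] with w hw
  rw [Function.comp_apply]
  have := pushforward_constField h y ((extChartAt (𝓡 n) p).map_target hw)
  rwa [(extChartAt (𝓡 n) p).right_inv hw] at this

end Chart

/-! ### Second order calculus along a map into a quadric -/

section Line

variable {E G : Type*} [NormedAddCommGroup E] [NormedSpace ℝ E] [NormedAddCommGroup G]
  [NormedSpace ℝ G] {h : E → G} {w : E}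

theorem ContDiffAt.eventually_differentiableAt_of_smooth (hh : ContDiffAt ℝ ∞ h w) :
    ∀ᶠ v in 𝓝 w, DifferentiableAt ℝ h v := by
  filter_upwards [(hh.of_le (m := 1) (by norm_cast)).eventually (by simp)] with v hv
  exact hv.differentiableAt (by norm_num)

theorem ContDiffAt.differentiableAt_fderiv_apply (hh : ContDiffAt ℝ ∞ h w) (y : E) :
    DifferentiableAt ℝ (fun v => fderiv ℝ h v y) w :=
  ((hh.fderiv_right (m := 1) (by norm_cast)).differentiableAt (by norm_num)).clm_apply
    (differentiableAt_const _)

theorem hasDerivAt_line (w y : E) (t : ℝ) : HasDerivAt (fun t : ℝ => w + t • y) y t := by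
  simpa using ((hasDerivAt_id t).smul_const y).const_add w

theorem tendsto_line (w y : E) : Tendsto (fun t : ℝ => w + t • y) (𝓝 0) (𝓝 w) := by
  simpa using (hasDerivAt_line w y 0).continuousAt.tendsto

theorem ContDiffAt.eventually_hasDerivAt_line (hh : ContDiffAt ℝ ∞ h w) (y : E) :
    ∀ᶠ t in 𝓝 (0 : ℝ), HasDerivAt (fun t : ℝ => h (w + t • y)) (fderiv ℝ h (w + t • y) y) t := by
  filter_upwards [(tendsto_line w y).eventually hh.eventually_differentiableAt_of_smooth] with t ht
  exact ht.hasFDerivAt.comp_hasDerivAt t (hasDerivAt_line w y t)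

theorem ContDiffAt.hasDerivAt_fderiv_line (hh : ContDiffAt ℝ ∞ h w) (y : E) :
    HasDerivAt (fun t : ℝ => fderiv ℝ h (w + t • y) y)
      (fderiv ℝ (fun v => fderiv ℝ h v y) w y) 0 := by
  have h1 : HasFDerivAt (fun v => fderiv ℝ h v y) (fderiv ℝ (fun v => fderiv ℝ h v y) w)
      (w + (0 : ℝ) • y) := by
    rw [zero_smul, add_zero]; exact (hh.differentiableAt_fderiv_apply y).hasFDerivAt
  exact h1.comp_hasDerivAt 0 (hasDerivAt_line w y 0)

/-- The second order necessary condition at a minimum: the first derivative vanishes and the second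
one is positive semidefinite. -/
theorem IsLocalMin.fderiv_fderiv_nonneg {l : G →L[ℝ] ℝ} (hh : ContDiffAt ℝ ∞ h w)
    (hmin : IsLocalMin (fun v => l (h v)) w) (y : E) :
    l (fderiv ℝ h w y) = 0 ∧ 0 ≤ l (fderiv ℝ (fun v => fderiv ℝ h v y) w y) := by
  set s : ℝ → ℝ := fun t => l (h (w + t • y)) with hsdef
  have hsmin : IsLocalMin s 0 := by
    filter_upwards [(tendsto_line w y).eventually hmin] with t ht
    simpa [hsdef] using ht
  have hs1 : ∀ᶠ t in 𝓝 (0 : ℝ), HasDerivAt s (l (fderiv ℝ h (w + t • y) y)) t := by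
    filter_upwards [hh.eventually_hasDerivAt_line y] with t ht
    exact l.hasFDerivAt.comp_hasDerivAt t ht
  have hs2 := l.hasFDerivAt.comp_hasDerivAt 0 (hh.hasDerivAt_fderiv_line y)
  have hd0 : deriv s 0 = 0 := hsmin.deriv_eq_zero
  have e1 := hs1.self_of_nhds.deriv
  rw [hd0, zero_smul, add_zero] at e1
  refine ⟨e1.symm, ?_⟩
  have hdd : deriv (deriv s) 0 = l (fderiv ℝ (fun v => fderiv ℝ h v y) w y) := by
    have : deriv s =ᶠ[𝓝 0] fun t => l (fderiv ℝ h (w + t • y) y) := by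
      filter_upwards [hs1] with t ht using ht.deriv
    rw [this.deriv_eq]; exact hs2.deriv
  rw [← hdd]
  by_contra hneg
  have hmax := isLocalMax_of_deriv_deriv_neg (not_le.1 hneg) hd0 hs1.self_of_nhds.continuousAt
  have hconst : s =ᶠ[𝓝 0] fun _ => s 0 := by
    filter_upwards [hmax, hsmin] with t h1 h2 using le_antisymm h1 h2
  have : deriv s =ᶠ[𝓝 0] fun _ => 0 := by
    filter_upwards [hconst.eventuallyEq_nhds] with t ht
    rw [ht.deriv_eq]; simp
  rw [this.deriv_eq] at hneg
  simp at hneg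

/-- If the product of the linear forms `l` and `m` vanishes on the displacements `h v - h w`, and
`l` has a non-zero second derivative in the direction `y`, then `m` vanishes to second order in
that direction. -/
theorem ContDiffAt.eq_zero_of_mul_eq_zero {l m : G →L[ℝ] ℝ} (hh : ContDiffAt ℝ ∞ h w)
    (hlm : ∀ v, l (h v - h w) * m (h v - h w) = 0) (y : E)
    (hl : l (fderiv ℝ (fun v => fderiv ℝ h v y) w y) ≠ 0) :
    m (fderiv ℝ h w y) = 0 ∧ m (fderiv ℝ (fun v => fderiv ℝ h v y) w y) = 0 := by
  have hs1 (k : G →L[ℝ] ℝ) : ∀ᶠ t in 𝓝 (0 : ℝ),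
      HasDerivAt (fun t : ℝ => k (h (w + t • y) - h w)) (k (fderiv ℝ h (w + t • y) y)) t := by
    filter_upwards [hh.eventually_hasDerivAt_line y] with t ht
    exact k.hasFDerivAt.comp_hasDerivAt t (ht.sub_const _)
  have hs2 (k : G →L[ℝ] ℝ) := k.hasFDerivAt.comp_hasDerivAt 0 (hh.hasDerivAt_fderiv_line y)
  have hne : ∀ᶠ t in 𝓝[≠] (0 : ℝ), l (fderiv ℝ h (w + t • y) y) ≠ 0 :=
    (hs2 l).eventually_ne hl
  -- Away from `0` the derivative of `l` does not vanish, so that the product rule leaves `m ^ 2 = 0`.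
  have hm : ∀ᶠ t in 𝓝 (0 : ℝ), m (h (w + t • y) - h w) = 0 := by
    have h1 : ∀ᶠ t in 𝓝[≠] (0 : ℝ), m (h (w + t • y) - h w) = 0 := by
      filter_upwards [hne, (hs1 l).filter_mono nhdsWithin_le_nhds,
        (hs1 m).filter_mono nhdsWithin_le_nhds] with t ht hlt hmt
      have hprod := (hlt.mul hmt).unique
        ((hasDerivAt_const t (0 : ℝ)).congr_of_eventuallyEq
          (Eventually.of_forall fun t => hlm (w + t • y)))
      have h2 := hlm (w + t • y)
      have h3 : l (fderiv ℝ h (w + t • y) y) * m (h (w + t • y) - h w) ^ 2 = 0 := by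
        linear_combination m (h (w + t • y) - h w) * hprod
          - m (fderiv ℝ h (w + t • y) y) * h2
      simpa [ht] using h3
    rw [eventually_nhdsWithin_iff] at h1
    filter_upwards [h1] with t ht
    by_cases h2 : t = 0
    · simp [h2]
    · exact ht h2
  have hm1 : ∀ᶠ t in 𝓝 (0 : ℝ), m (fderiv ℝ h (w + t • y) y) = 0 := by
    filter_upwards [hm.eventually_nhds, hs1 m] with t ht hmt
    exact hmt.unique ((hasDerivAt_const t (0 : ℝ)).congr_of_eventuallyEq ht)
  refine ⟨by simpa using hm1.self_of_nhds, ?_⟩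
  exact (hs2 m).unique ((hasDerivAt_const (0 : ℝ) (0 : ℝ)).congr_of_eventuallyEq hm1)

/-- The first derivative of the equation of a quadric along a map into it. -/
theorem quadric_fderiv {β : G →L[ℝ] G →L[ℝ] ℝ} {b : G →L[ℝ] ℝ} {c : ℝ}
    (hβ : ∀ u v, β u v = β v u) (hF : ∀ v, β (h v) (h v) / 2 + b (h v) + c = 0)
    (hh : DifferentiableAt ℝ h w) (y : E) :
    β (h w) (fderiv ℝ h w y) + b (fderiv ℝ h w y) = 0 := by
  have h1 := ((β.hasFDerivAt.comp w hh.hasFDerivAt).clm_apply hh.hasFDerivAt).mul_const (1 / 2 : ℝ)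
  have h2 := (h1.add (b.hasFDerivAt.comp w hh.hasFDerivAt)).add_const c
  have h3 := h2.congr_of_eventuallyEq (f₁ := fun _ => (0 : ℝ))
    (Eventually.of_forall fun w => by
      have := hF w
      simp only [Function.comp_apply, Pi.add_apply] at this ⊢
      linarith)
  have h4 := congrArg (fun L => L y) (h3.unique (hasFDerivAt_const (0 : ℝ) w))
  simp at h4
  have h5 := hβ (fderiv ℝ h w y) (h w)
  linarith

/-- The second derivative of the equation of a quadric along a map into it. -/
theorem quadric_fderiv_fderiv {β : G →L[ℝ] G →L[ℝ] ℝ} {b : G →L[ℝ] ℝ} {c : ℝ}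
    (hβ : ∀ u v, β u v = β v u) (hF : ∀ v, β (h v) (h v) / 2 + b (h v) + c = 0)
    (hh : ContDiffAt ℝ ∞ h w) (z y : E) :
    β (h w) (fderiv ℝ (fun v => fderiv ℝ h v y) w z) + b (fderiv ℝ (fun v => fderiv ℝ h v y) w z)
      = - β (fderiv ℝ h w z) (fderiv ℝ h w y) := by
  have hd := hh.eventually_differentiableAt_of_smooth
  have h1 := (((β.hasFDerivAt.comp w hd.self_of_nhds.hasFDerivAt).add_const b).clm_apply
    (hh.differentiableAt_fderiv_apply y).hasFDerivAt)
  have h3 := h1.congr_of_eventuallyEq (f₁ := fun _ => (0 : ℝ)) (by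
    filter_upwards [hd] with v hv
    exact (quadric_fderiv hβ hF hv y).symm)
  have h4 := congrArg (fun L => L z) (h3.unique (hasFDerivAt_const (0 : ℝ) w))
  simp at h4
  linarith

end Line

section Quadratic

variable {n : ℕ} {P : Type*} [TopologicalSpace P] [ChartedSpace (RealSpace n) P]

/-- `β` is symmetric, and the map `φ` takes its values in the zero set of the quadratic polynomial
`β (x, x) / 2 + b x + c`. -/
structure LiesOnQuadric (β : RealSpace 4 →L[ℝ] RealSpace 4 →L[ℝ] ℝ) (b : RealSpace 4 →L[ℝ] ℝ)
    (c : ℝ) (φ : P → RealSpace 4) : Prop where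
  symm : ∀ u v, β u v = β v u
  eq_zero : ∀ p, β (φ p) (φ p) / 2 + b (φ p) + c = 0

variable {β : RealSpace 4 →L[ℝ] RealSpace 4 →L[ℝ] ℝ} {b : RealSpace 4 →L[ℝ] ℝ} {c : ℝ}
  {φ : P → RealSpace 4}

theorem comp_extChartAt_symm_self (φ : P → RealSpace 4) (p : P) :
    (φ ∘ (extChartAt (𝓡 n) p).symm) (extChartAt (𝓡 n) p p) = φ p := by
  rw [Function.comp_apply, extChartAt_to_inv]

theorem LiesOnQuadric.gradient_diffAt (hQ : LiesOnQuadric β b c φ) {p : P}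
    (hφ : ContMDiffAt (𝓡 n) 𝓘(ℝ, RealSpace 4) ∞ φ p) (y : TangentSpace (𝓡 n) p) :
    β (φ p) (diffAt n φ p y) + b (diffAt n φ p y) = 0 := by
  rw [diffAt_eq_fderiv (hφ.mdifferentiableAt (by simp)), ← comp_extChartAt_symm_self (n := n) φ p]
  exact quadric_fderiv hQ.symm (fun v => hQ.eq_zero _)
    ((contDiffAt_comp_extChartAt_symm hφ).differentiableAt (by simp)) y

/-- The gradient of the quadric, a conormal, turns the second fundamental form into the opposite of
the Hessian. -/
theorem LiesOnQuadric.gradient_secondDerivAt (hQ : LiesOnQuadric β b c φ) {p : P}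
    (hφ : ContMDiffAt (𝓡 n) 𝓘(ℝ, RealSpace 4) ∞ φ p) (z y : TangentSpace (𝓡 n) p) :
    β (φ p) (secondDerivAt n φ p z y) + b (secondDerivAt n φ p z y) =
      - β (diffAt n φ p z) (diffAt n φ p y) := by
  rw [diffAt_eq_fderiv (hφ.mdifferentiableAt (by simp)), ← comp_extChartAt_symm_self (n := n) φ p]
  exact quadric_fderiv_fderiv hQ.symm (fun v => hQ.eq_zero _)
    (contDiffAt_comp_extChartAt_symm hφ) z y

/-- A form that supports the hypersurface at `p` is a conormal, positive semidefinite on the second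
fundamental form. -/
theorem support_diffAt {l : RealSpace 4 →L[ℝ] ℝ} {p : P}
    (hφ : ContMDiffAt (𝓡 n) 𝓘(ℝ, RealSpace 4) ∞ φ p)
    (hl : ∀ᶠ q in 𝓝 p, l (φ p) ≤ l (φ q)) (y : TangentSpace (𝓡 n) p) :
    l (diffAt n φ p y) = 0 ∧ 0 ≤ l (secondDerivAt n φ p y y) := by
  rw [diffAt_eq_fderiv (hφ.mdifferentiableAt (by simp))]
  refine IsLocalMin.fderiv_fderiv_nonneg (contDiffAt_comp_extChartAt_symm hφ) ?_ y
  have hc : Tendsto (extChartAt (𝓡 n) p).symm (𝓝 (extChartAt (𝓡 n) p p)) (𝓝 p) := by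
    simpa [ContinuousAt] using continuousAt_extChartAt_symm (I := 𝓡 n) p
  filter_upwards [hc.eventually hl] with w hw
  rwa [comp_extChartAt_symm_self]

theorem eq_zero_of_mul_eq_zero {l m : RealSpace 4 →L[ℝ] ℝ} {p : P}
    (hφ : ContMDiffAt (𝓡 n) 𝓘(ℝ, RealSpace 4) ∞ φ p)
    (hlm : ∀ q, l (φ q - φ p) * m (φ q - φ p) = 0) (y : TangentSpace (𝓡 n) p)
    (hl : l (secondDerivAt n φ p y y) ≠ 0) :
    m (diffAt n φ p y) = 0 ∧ m (secondDerivAt n φ p y y) = 0 := by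
  rw [diffAt_eq_fderiv (hφ.mdifferentiableAt (by simp))]
  refine (contDiffAt_comp_extChartAt_symm hφ).eq_zero_of_mul_eq_zero (fun v => ?_) y hl
  rw [comp_extChartAt_symm_self]
  exact hlm _

end Quadratic

/-! ### Quadratic polynomials, conormals and Gram determinants -/

section Polynomial

/-- The bilinear form on `ℝ⁴` given by a matrix. -/
noncomputable def matrixForm (B : Matrix (Fin 4) (Fin 4) ℝ) :
    RealSpace 4 →L[ℝ] RealSpace 4 →L[ℝ] ℝ :=
  LinearMap.toContinuousBilinearMap
    ((Matrix.toLinearMap₂' ℝ B).compl₁₂ (WithLp.linearEquiv 2 ℝ (Fin 4 → ℝ)).toLinearMap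
      (WithLp.linearEquiv 2 ℝ (Fin 4 → ℝ)).toLinearMap)

theorem matrixForm_apply (B : Matrix (Fin 4) (Fin 4) ℝ) (u v : RealSpace 4) :
    matrixForm B u v = u.ofLp ⬝ᵥ B.mulVec v.ofLp :=
  Matrix.toLinearMap₂'_apply' B _ _

theorem matrixForm_comm {B : Matrix (Fin 4) (Fin 4) ℝ} (hB : B.IsSymm) (u v : RealSpace 4) :
    matrixForm B u v = matrixForm B v u := by
  rw [matrixForm_apply, matrixForm_apply, Matrix.dotProduct_mulVec, ← Matrix.mulVec_transpose,
    hB.eq, dotProduct_comm]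

/-- The linear form on `ℝ⁴` given by a vector of coefficients. -/
noncomputable def vectorForm (b : Fin 4 → ℝ) : RealSpace 4 →L[ℝ] ℝ :=
  innerSL ℝ (WithLp.toLp 2 b : RealSpace 4)

theorem vectorForm_apply (b : Fin 4 → ℝ) (u : RealSpace 4) : vectorForm b u = b ⬝ᵥ u.ofLp := by
  simp [vectorForm, PiLp.inner_apply, dotProduct, mul_comm]

/-- A polynomial of degree at most two is the sum of a quadratic form, a linear form and a
constant. -/
theorem MvPolynomial.exists_eval_eq_of_totalDegree_le_two {σ : Type*} [Fintype σ] [DecidableEq σ]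
    (F : MvPolynomial σ ℝ) (hF : F.totalDegree ≤ 2) :
    ∃ (B : Matrix σ σ ℝ) (b : σ → ℝ) (c : ℝ), B.IsSymm ∧
      ∀ x : σ → ℝ, MvPolynomial.eval x F = (x ⬝ᵥ B.mulVec x) / 2 + b ⬝ᵥ x + c := by
  let p : MvPolynomial σ ℝ → Prop := fun F => ∃ (B : Matrix σ σ ℝ) (b : σ → ℝ) (c : ℝ), B.IsSymm ∧
      ∀ x : σ → ℝ, MvPolynomial.eval x F = (x ⬝ᵥ B.mulVec x) / 2 + b ⬝ᵥ x + c
  have hadd : ∀ F G, p F → p G → p (F + G) := by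
    rintro F G ⟨B, b, c, hB, h⟩ ⟨B', b', c', hB', h'⟩
    refine ⟨B + B', b + b', c + c', hB.add hB', fun x => ?_⟩
    rw [map_add, h, h', Matrix.add_mulVec, dotProduct_add, add_dotProduct]
    ring
  have hzero : p 0 := ⟨0, 0, 0, Matrix.isSymm_zero, fun x => by simp⟩
  have hmon : ∀ m ∈ F.support, p (MvPolynomial.monomial m (F.coeff m)) := by
    intro m hm
    have hdeg : m.toMultiset.card ≤ 2 := by
      rw [Finsupp.card_toMultiset]
      exact (MvPolynomial.le_totalDegree hm).trans hF
    set a := F.coeff m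
    have heval : ∀ x : σ → ℝ, MvPolynomial.eval x (MvPolynomial.monomial m a) =
        a * (m.toMultiset.map x).prod := fun x => by
      rw [MvPolynomial.eval_monomial, Finsupp.toMultiset_map, Finsupp.prod_toMultiset]
      rw [Finsupp.prod_mapDomain_index (by simp) (fun _ _ _ => pow_add _ _ _)]
    generalize m.toMultiset = s at hdeg heval
    have h012 : s.card = 0 ∨ s.card = 1 ∨ s.card = 2 := by omega
    rcases h012 with h | h | h
    · rw [Multiset.card_eq_zero] at h
      exact ⟨0, 0, a, Matrix.isSymm_zero, fun x => by rw [heval]; simp [h]⟩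
    · obtain ⟨i, rfl⟩ := Multiset.card_eq_one.1 h
      exact ⟨0, Pi.single i a, 0, Matrix.isSymm_zero, fun x => by rw [heval]; simp⟩
    · obtain ⟨i, j, rfl⟩ := Multiset.card_eq_two.1 h
      refine ⟨Matrix.single i j a + Matrix.single j i a, 0, 0, ?_, fun x => ?_⟩
      · rw [Matrix.IsSymm, Matrix.transpose_add, Matrix.transpose_single, Matrix.transpose_single,
          add_comm]
      · rw [heval, Matrix.add_mulVec, dotProduct_add]
        have hs : ∀ (i : σ) (r : ℝ), x ⬝ᵥ Function.update 0 i r = x i * r :=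
          fun i r => dotProduct_single x r i
        simp [Matrix.single_mulVec, hs]
        ring
  have := Finset.sum_induction (fun m => MvPolynomial.monomial m (F.coeff m)) p hadd hzero hmon
  rwa [MvPolynomial.support_sum_monomial_coeff] at this

end Polynomial

section Linear

/-- The null vectors of a non-zero linear form that vanishes on the image of an injective map from
a space of dimension three are the vectors of that image. -/
theorem exists_eq_of_apply_eq_zero {V : Type*} [AddCommGroup V] [Module ℝ V]
    (hV : Module.finrank ℝ V = 3) {A : V →ₗ[ℝ] RealSpace 4} (hA : Function.Injective A)
    {l : RealSpace 4 →L[ℝ] ℝ} (hl : l ≠ 0) (hlA : ∀ y, l (A y) = 0) {w : RealSpace 4}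
    (hw : l w = 0) : ∃ y, A y = w := by
  have : FiniteDimensional ℝ V := FiniteDimensional.of_injective A hA
  have h1 : Module.finrank ℝ (LinearMap.range A) = 3 := by
    rw [LinearMap.finrank_range_of_inj hA, hV]
  have hl' : l.toLinearMap ≠ 0 := fun h => hl (by ext u; exact congrArg (fun L => L u) h)
  have h2 := Module.Dual.finrank_ker_add_one_of_ne_zero (f := l.toLinearMap) hl'
  have h3 : Module.finrank ℝ (RealSpace 4) = 4 := by simp
  have hle : LinearMap.range A ≤ LinearMap.ker l.toLinearMap := by
    rintro _ ⟨y, rfl⟩; exact hlA y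
  have := Submodule.eq_of_le_of_finrank_eq hle (by omega)
  have hw' : w ∈ LinearMap.ker l.toLinearMap := hw
  rw [← this] at hw'
  exact hw'

theorem exists_apply_eq_one {l : RealSpace 4 →L[ℝ] ℝ} (hl : l ≠ 0) : ∃ w, l w = 1 := by
  obtain ⟨w, hw⟩ : ∃ w, l w ≠ 0 := by
    by_contra! h; exact hl (by ext u; exact h u)
  exact ⟨(l w)⁻¹ • w, by simp [hw]⟩

theorem exists_eq_smul_of_forall_apply_eq_zero {V : Type*} [AddCommGroup V] [Module ℝ V]
    (hV : Module.finrank ℝ V = 3) {A : V →ₗ[ℝ] RealSpace 4} (hA : Function.Injective A)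
    {g l : RealSpace 4 →L[ℝ] ℝ} (hg : g ≠ 0) (hgA : ∀ y, g (A y) = 0) (hlA : ∀ y, l (A y) = 0) :
    ∃ m : ℝ, ∀ w, l w = m * g w := by
  obtain ⟨w₀, hw₀⟩ := exists_apply_eq_one hg
  refine ⟨l w₀, fun w => ?_⟩
  obtain ⟨y, hy⟩ := exists_eq_of_apply_eq_zero hV hA hg hgA (w := w - g w • w₀) (by simp [hw₀])
  have h := hlA y
  rw [hy, map_sub, map_smul, smul_eq_mul] at h
  linarith

end Linear

section FifthRoot

theorem fifthRoot_neg (t : ℝ) : fifthRoot (-t) = -fifthRoot t := by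
  simp [fifthRoot, Real.sign_neg]

theorem fifthRoot_pos {t : ℝ} (ht : 0 < t) : 0 < fifthRoot t := by
  unfold fifthRoot
  rw [Real.sign_of_pos ht]
  positivity

theorem fifthRoot_pow_mul {a : ℝ} (ha : a ≠ 0) (t : ℝ) :
    fifthRoot (a ^ 5 * t) = a * fifthRoot t := by
  have h1 : |a ^ 5 * t| ^ ((1 : ℝ) / 5) = |a| * |t| ^ ((1 : ℝ) / 5) := by
    rw [abs_mul, abs_pow, Real.mul_rpow (by positivity) (abs_nonneg _), ← Real.rpow_natCast,
      ← Real.rpow_mul (abs_nonneg _)]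
    norm_num
  have h2 : ∀ t, 0 < a → Real.sign (a ^ 5 * t) = Real.sign t := fun t ha => by
    rcases lt_trichotomy t 0 with h | rfl | h
    · rw [Real.sign_of_neg h, Real.sign_of_neg (mul_neg_of_pos_of_neg (by positivity) h)]
    · simp
    · rw [Real.sign_of_pos h, Real.sign_of_pos (by positivity)]
  unfold fifthRoot
  rw [h1]
  rcases lt_or_gt_of_ne ha with h | h
  · have h3 : Real.sign (a ^ 5 * t) = - Real.sign t := by
      have h5 : 0 < -a := by linarith
      rcases lt_trichotomy t 0 with h | rfl | h
      · rw [Real.sign_of_neg h, Real.sign_of_pos]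
        · simp
        · nlinarith [pow_pos h5 5]
      · simp
      · rw [Real.sign_of_pos h, Real.sign_of_neg]
        nlinarith [pow_pos h5 5]
    rw [h3, abs_of_neg h]; ring
  · rw [h2 t h, abs_of_pos h]; ring

end FifthRoot

section Bracket

theorem adjugate_apply_eq_bracket (a b c d : RealSpace 4) (i : Fin 4) :
    (Matrix.of fun i j : Fin 4 => (![a, b, c, d] i) j).adjugate i 3 =
      bracket a b c (EuclideanSpace.single i 1) := by
  rw [Matrix.adjugate_apply, bracket]
  congr 1
  ext k l
  fin_cases k <;> simp [Matrix.updateRow_apply, Pi.single_apply]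

/-- The expansion of the determinant along its last row. -/
theorem bracket_eq_sum (a b c w : RealSpace 4) :
    bracket a b c w = ∑ i, w i * bracket a b c (EuclideanSpace.single i 1) := by
  conv_lhs => rw [bracket, Matrix.det_eq_sum_mul_adjugate_row _ 3]
  simp only [adjugate_apply_eq_bracket]
  simp

/-- The Gram determinant of three vectors for a bilinear form is the value of the adjugate form on
their cross product. -/
theorem det_gram_eq_adjugate (B : Matrix (Fin 4) (Fin 4) ℝ) (u : Fin 3 → RealSpace 4) :
    (Matrix.of fun i j : Fin 3 => matrixForm B (u i) (u j)).det =
      (fun i => bracket (u 0) (u 1) (u 2) (EuclideanSpace.single i 1)) ⬝ᵥ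
        B.adjugate.mulVec (fun i => bracket (u 0) (u 1) (u 2) (EuclideanSpace.single i 1)) := by
  let W : Matrix (Fin 4) (Fin 4) ℝ := Matrix.of fun i j => (![u 0, u 1, u 2, 0] i) j
  have hW : ∀ i, W.adjugate i 3 = bracket (u 0) (u 1) (u 2) (EuclideanSpace.single i 1) :=
    adjugate_apply_eq_bracket _ _ _ _
  -- Both sides are the last diagonal entry of the adjugate of `W B Wᵀ`: its cofactor is the Gram
  -- determinant, and the last column of the adjugate of `W` is the cross product.
  have h1 : (W * B * W.transpose).adjugate 3 3 =
      (Matrix.of fun i j : Fin 3 => matrixForm B (u i) (u j)).det := by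
    rw [Matrix.adjugate_fin_succ_eq_det_submatrix]
    have : ((-1 : ℝ) ^ ((3 : Fin 4) + (3 : Fin 4) : ℕ)) = 1 := by norm_num
    rw [this, one_mul]
    congr 1
    ext i j
    rw [Matrix.of_apply, matrixForm_apply, Matrix.submatrix_apply, Matrix.mul_assoc]
    fin_cases i <;> fin_cases j <;>
      simp [W, Matrix.mul_apply, dotProduct, Matrix.mulVec, Fin.succAbove]
  rw [← h1, Matrix.adjugate_mul_distrib, Matrix.adjugate_mul_distrib,
    ← Matrix.adjugate_transpose]
  simp only [Matrix.mul_apply, Matrix.transpose_apply, hW, dotProduct, Matrix.mulVec]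

end Bracket

/-! ### The Blaschke metric of a convex hypersurface of a quadric -/

section Convex

theorem clm_apply_add_smul {E G : Type*} [NormedAddCommGroup E] [NormedSpace ℝ E]
    [NormedAddCommGroup G] [NormedSpace ℝ G] (D : E →L[ℝ] E →L[ℝ] G) (z y : E) (t : ℝ) :
    D (z + t • y) (z + t • y) = D z z + t • D z y + t • D y z + (t * t) • D y y := by
  simp only [map_add, map_smul, add_apply, smul_apply]
  module

variable {N : Type*} [TopologicalSpace N] [ChartedSpace (RealSpace 3) N]
  {ι : N → RealSpace 4} {x : N}

/-- The support form of a strictly convex hypersurface is a conormal with positive definite second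
fundamental form. -/
theorem IsLocallyStrictlyConvexAt.exists_conormal (hN : IsLocallyStrictlyConvexAt 3 ι x)
    (hι : ContMDiffAt (𝓡 3) 𝓘(ℝ, RealSpace 4) ∞ ι x) :
    ∃ l : RealSpace 4 →L[ℝ] ℝ, l ≠ 0 ∧ (∀ y, l (diffAt 3 ι x y) = 0) ∧
      ∀ y, y ≠ 0 → 0 < l (secondDerivAt 3 ι x y y) := by
  obtain ⟨l, hl0, hl, hnd⟩ := hN
  refine ⟨l, hl0, fun y => (support_diffAt hι hl y).1, fun y hy => ?_⟩
  refine lt_of_le_of_ne (support_diffAt hι hl y).2 fun h0 => hy (hnd y fun z => ?_)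
  by_contra hz
  -- The quadratic form would take a negative value at `z + t y` for a suitable `t`.
  set Q := l (secondDerivAt 3 ι x z z)
  set R := l (secondDerivAt 3 ι x z y) with hR
  set t : ℝ := -(Q + 1) / (2 * R)
  have h1 := (support_diffAt hι hl (z + t • y)).2
  have h2 : l (secondDerivAt 3 ι x (z + t • y) (z + t • y)) = Q + 2 * t * R := by
    have hsymm := secondDerivAt_comm hι y z
    simp only [secondDerivAt_eq hι] at hsymm h0 hR ⊢
    have e : l (secondDerivAt 3 ι x z z) = Q := rfl
    rw [secondDerivAt_eq hι] at e
    set D : RealSpace 3 →L[ℝ] RealSpace 3 →L[ℝ] RealSpace 4 :=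
      fderiv ℝ (fderiv ℝ (ι ∘ (extChartAt (𝓡 3) x).symm)) (extChartAt (𝓡 3) x x)
    have e1 : D (z + t • y) (z + t • y) = D z z + t • D z y + t • D y z + (t * t) • D y y :=
      clm_apply_add_smul D z y t
    refine (congrArg l e1).trans ?_
    rw [map_add, map_add, map_add, map_smul, map_smul, map_smul, ← h0, e, hsymm, ← hR]
    simp only [smul_eq_mul]; ring
  rw [h2] at h1
  have h3 : 2 * t * R = -(Q + 1) := by
    simp only [t]; field_simp
  linarith

end Convex

section Hypersurface

variable {N : Type*} [TopologicalSpace N] [ChartedSpace (RealSpace 3) N]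
  {ι : N → RealSpace 4}

theorem finrank_tangentSpace (x : N) : Module.finrank ℝ (TangentSpace (𝓡 3) x) = 3 :=
  finrank_euclideanSpace_fin (𝕜 := ℝ) (n := 3)

/-- A strictly convex hypersurface does not meet the singular set of a quadric that contains it: at a
singular point the quadric would be the union of two hyperplanes, one of them the tangent one. The
hypersurface meets the latter, near that point, in the point only, so that it would lie in the other one. -/
theorem LiesOnQuadric.gradient_ne_zero {β : RealSpace 4 →L[ℝ] RealSpace 4 →L[ℝ] ℝ}
    {b : RealSpace 4 →L[ℝ] ℝ} {c : ℝ} (hQ : LiesOnQuadric β b c ι)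
    (hF : ∃ v, β v v / 2 + b v + c ≠ 0) (hι : IsSmoothImmersion 3 ι) {x : N}
    (hN : IsLocallyStrictlyConvexAt 3 ι x) : β (ι x) + b ≠ 0 := by
  intro hg
  have hιx := hι.1.contMDiffAt (x := x)
  obtain ⟨l, hl0, hlT, hlpos⟩ := hN.exists_conormal hιx
  have hg' : ∀ w, β (ι x) w + b w = 0 := fun w => congrArg (fun L => L w) hg
  have hβT : ∀ y z, β (diffAt 3 ι x y) (diffAt 3 ι x z) = 0 := fun y z => by
    have := hQ.gradient_secondDerivAt hιx y z
    rw [hg'] at this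
    linarith
  obtain ⟨w₀, hw₀⟩ := exists_apply_eq_one hl0
  have hT : ∀ w, ∃ y, diffAt 3 ι x y = w - l w • w₀ := fun w =>
    exists_eq_of_apply_eq_zero (finrank_tangentSpace x) (A := (diffAt 3 ι x).toLinearMap) (hι.2 x)
      hl0 hlT (by simp [hw₀])
  -- At a singular point the quadratic form is the product of `l` and the linear form `m`.
  let m : RealSpace 4 →L[ℝ] ℝ := (2 : ℝ) • β w₀ - β w₀ w₀ • l
  have hm : ∀ u, m u = 2 * β w₀ u - β w₀ w₀ * l u := fun u => rfl
  have hlm : ∀ u, l u * m u = β u u := fun u => by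
    obtain ⟨y, hy⟩ := hT u
    have h1 := hβT y y
    rw [hy] at h1
    simp only [map_sub, map_smul, sub_apply, smul_apply, smul_eq_mul] at h1
    have h2 := hQ.symm u w₀
    rw [hm]
    linear_combination (-1 : ℝ) * h1 - l u * h2
  have hzero : ∀ q, l (ι q - ι x) * m (ι q - ι x) = 0 := fun q => by
    have h1 := hQ.eq_zero q
    have h2 := hQ.eq_zero x
    have h3 := hg' (ι q - ι x)
    have h4 := hQ.symm (ι q) (ι x)
    rw [hlm]
    simp only [map_sub, sub_apply] at h3 ⊢
    linear_combination 2 * h1 - 2 * h2 - 2 * h3 - h4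
  have hmT : ∀ y, y ≠ 0 → m (diffAt 3 ι x y) = 0 ∧ m (secondDerivAt 3 ι x y y) = 0 := fun y hy =>
    eq_zero_of_mul_eq_zero hιx hzero y (hlpos y hy).ne'
  have hmw : ∀ w, m w = l w * m w₀ := fun w => by
    obtain ⟨y, hy⟩ := hT w
    have h1 : m (diffAt 3 ι x y) = 0 := by
      by_cases h : y = 0
      · rw [h, map_zero, map_zero]
      · exact (hmT y h).1
    rw [hy, map_sub, map_smul, smul_eq_mul] at h1
    linarith
  have hm0 : m w₀ = 0 := by
    have hne : (EuclideanSpace.single 0 1 : RealSpace 3) ≠ 0 := by simp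
    have h1 := (hmT (EuclideanSpace.single 0 1 : RealSpace 3) hne).2
    rw [hmw] at h1
    exact (mul_eq_zero.1 h1).resolve_left (hlpos _ hne).ne'
  obtain ⟨v, hv⟩ := hF
  apply hv
  have h1 := hlm (v - ι x)
  rw [hmw, hm0, mul_zero, mul_zero] at h1
  have h2 := hQ.eq_zero x
  have h3 := hg' (v - ι x)
  have h4 := hQ.symm v (ι x)
  simp only [map_sub, sub_apply] at h1 h3
  linear_combination (-1 / 2 : ℝ) * h1 + h2 + h3 + h4 / 2

end Hypersurface

section Blaschke

/-- The value of the adjugate of the Hessian matrix at the gradient of the quadric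
`x ⬝ B x / 2 + b ⬝ x + c = 0`; it is the same at every point of the quadric. -/
noncomputable def quadricInvariant (B : Matrix (Fin 4) (Fin 4) ℝ) (b : Fin 4 → ℝ) (c : ℝ) : ℝ :=
  b ⬝ᵥ B.adjugate.mulVec b - 2 * c * B.det

theorem gradient_adjugate_gradient {B : Matrix (Fin 4) (Fin 4) ℝ} (hB : B.IsSymm) (b : Fin 4 → ℝ)
    {c : ℝ} {X : Fin 4 → ℝ} (hX : (X ⬝ᵥ B.mulVec X) / 2 + b ⬝ᵥ X + c = 0) :
    (B.mulVec X + b) ⬝ᵥ B.adjugate.mulVec (B.mulVec X + b) = quadricInvariant B b c := by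
  have h1 : B.adjugate.mulVec (B.mulVec X) = B.det • X := by
    rw [Matrix.mulVec_mulVec, Matrix.adjugate_mul, Matrix.smul_mulVec, Matrix.one_mulVec]
  have h2 : B.mulVec X ⬝ᵥ B.adjugate.mulVec b = B.det * (b ⬝ᵥ X) := by
    rw [Matrix.dotProduct_mulVec, ← Matrix.mulVec_transpose, Matrix.adjugate_transpose, hB.eq, h1,
      smul_dotProduct, smul_eq_mul, dotProduct_comm]
  have h3 := dotProduct_comm (B.mulVec X) X
  rw [Matrix.mulVec_add, dotProduct_add, add_dotProduct, add_dotProduct, h1, h2,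
    dotProduct_smul, dotProduct_smul, h3, quadricInvariant]
  simp only [smul_eq_mul]
  linear_combination 2 * B.det * hX

variable {N : Type*} [TopologicalSpace N] [ChartedSpace (RealSpace 3) N]
  {ι : N → RealSpace 4} {B : Matrix (Fin 4) (Fin 4) ℝ} {b : Fin 4 → ℝ} {c : ℝ}

theorem exists_eq_sum_coordFrame (x : N) (y : TangentSpace (𝓡 3) x) :
    ∃ a : Fin 3 → ℝ, y = ∑ i, a i • coordFrame x i := by
  have h : ∀ y : RealSpace 3, y = ∑ i, y i • (EuclideanSpace.single i (1 : ℝ)) := fun y => by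
    ext j
    simp [Pi.single_apply]
  exact ⟨_, h y⟩

theorem linearIndependent_coordFrame (x : N) : LinearIndependent ℝ (coordFrame x) := by
  have h := (EuclideanSpace.basisFun (Fin 3) ℝ).toBasis.linearIndependent
  have e : ⇑(EuclideanSpace.basisFun (Fin 3) ℝ).toBasis =
    fun i => (EuclideanSpace.single i (1 : ℝ) : RealSpace 3) := by ext; simp
  rw [e] at h
  exact h

theorem bracket_last (u : Fin 3 → RealSpace 4) (i : Fin 3) :
    bracket (u 0) (u 1) (u 2) (u i) = 0 := by
  unfold bracket
  fin_cases i
  · exact Matrix.det_zero_of_row_eq (i := 0) (j := 3) (by decide) (by ext; simp)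
  · exact Matrix.det_zero_of_row_eq (i := 1) (j := 3) (by decide) (by ext; simp)
  · exact Matrix.det_zero_of_row_eq (i := 2) (j := 3) (by decide) (by ext; simp)

/-- The linear form `[a, b, c, ·]`. -/
noncomputable def bracketForm (a b c : RealSpace 4) : RealSpace 4 →L[ℝ] ℝ :=
  vectorForm fun i => bracket a b c (EuclideanSpace.single i 1)

theorem bracketForm_apply (a b c w : RealSpace 4) : bracketForm a b c w = bracket a b c w := by
  rw [bracketForm, vectorForm_apply, bracket_eq_sum a b c w, dotProduct]
  exact Finset.sum_congr rfl fun i _ => mul_comm _ _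

/-- The conormal of the coordinate frame is a non-zero multiple of the gradient of the quadric. -/
theorem exists_bracket_eq_mul_gradient (hι : IsSmoothImmersion 3 ι) {x : N}
    {g : RealSpace 4 →L[ℝ] ℝ} (hg : g ≠ 0) (hgT : ∀ y, g (diffAt 3 ι x y) = 0) :
    ∃ k : ℝ, k ≠ 0 ∧ ∀ w, bracket (diffAt 3 ι x (coordFrame x 0)) (diffAt 3 ι x (coordFrame x 1))
      (diffAt 3 ι x (coordFrame x 2)) w = k * g w := by
  set u : Fin 3 → RealSpace 4 := fun i => diffAt 3 ι x (coordFrame x i) with hu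
  have hνT : ∀ y, bracketForm (u 0) (u 1) (u 2) (diffAt 3 ι x y) = 0 := fun y => by
    obtain ⟨a, rfl⟩ := exists_eq_sum_coordFrame x y
    rw [map_sum, map_sum]
    refine Finset.sum_eq_zero fun i _ => ?_
    rw [map_smul, map_smul, bracketForm_apply, bracket_last u i, smul_zero]
  obtain ⟨k, hk⟩ := exists_eq_smul_of_forall_apply_eq_zero (finrank_tangentSpace x)
    (A := (diffAt 3 ι x).toLinearMap) (hι.2 x) hg hgT hνT
  refine ⟨k, fun hk0 => ?_, fun w => by rw [← bracketForm_apply]; exact hk w⟩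
  obtain ⟨w₀, hw₀⟩ := exists_apply_eq_one hg
  have hli := linearIndependent_coordFrame x
  have hu' : LinearIndependent ℝ u :=
    hli.map' (diffAt 3 ι x).toLinearMap (LinearMap.ker_eq_bot.2 (hι.2 x))
  have hw₀u : w₀ ∉ Submodule.span ℝ (Set.range u) := fun h => by
    have : Submodule.span ℝ (Set.range u) ≤ LinearMap.ker g.toLinearMap := by
      rw [Submodule.span_le]
      rintro _ ⟨i, rfl⟩
      exact hgT _
    have h0 : g w₀ = 0 := this h
    rw [h0] at hw₀
    exact zero_ne_one hw₀
  have h4 := LinearIndependent.finSnoc hu' hw₀u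
  have h0 : bracket (u 0) (u 1) (u 2) w₀ = 0 := by
    rw [← bracketForm_apply, hk, hk0, zero_mul]
  have h5 : LinearIndependent ℝ
      (Matrix.of fun i j : Fin 4 => (![u 0, u 1, u 2, w₀] i) j).row := by
    have h6 := h4.map' (WithLp.linearEquiv 2 ℝ (Fin 4 → ℝ)).toLinearMap (LinearEquiv.ker _)
    convert! h6 using 1
    ext i j
    fin_cases i <;> rfl
  rw [Matrix.linearIndependent_rows_iff_isUnit, Matrix.isUnit_iff_isUnit_det] at h5
  exact h5.ne_zero h0

theorem gradient_single (hB : B.IsSymm) (b : Fin 4 → ℝ) (X : RealSpace 4) (i : Fin 4) :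
    (matrixForm B X + vectorForm b) (EuclideanSpace.single i 1) = (B.mulVec X.ofLp + b) i := by
  rw [add_apply, matrixForm_comm hB, matrixForm_apply, vectorForm_apply]
  simp

/-- The Gram determinant of a frame of the tangent space in terms of the proportionality factor `k` of its
conormal and the gradient. -/
theorem LiesOnQuadric.det_gram {P : Type*} {φ : P → RealSpace 4} (hB : B.IsSymm)
    (hQ : LiesOnQuadric (matrixForm B) (vectorForm b) c φ) {x : P} {k : ℝ}
    {u : Fin 3 → RealSpace 4} (hk : ∀ w, bracket (u 0) (u 1) (u 2) w =
      k * (matrixForm B (φ x) + vectorForm b) w) :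
    (Matrix.of fun i j : Fin 3 => matrixForm B (u i) (u j)).det =
      k ^ 2 * quadricInvariant B b c := by
  have hX := hQ.eq_zero x
  rw [matrixForm_apply, vectorForm_apply] at hX
  rw [det_gram_eq_adjugate, ← gradient_adjugate_gradient hB b hX]
  have : (fun i => bracket (u 0) (u 1) (u 2) (EuclideanSpace.single i 1)) =
      k • (B.mulVec (φ x).ofLp + b) := by
    ext i
    rw [hk, gradient_single hB, Pi.smul_apply, smul_eq_mul]
  rw [this, Matrix.mulVec_smul, dotProduct_smul, smul_dotProduct]
  simp only [smul_eq_mul]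
  ring

/-- The Blaschke metric of a strictly convex hypersurface contained in a quadric is a constant multiple
of the Hessian of the quadric. -/
theorem LiesOnQuadric.blaschkeMetric_eq (hB : B.IsSymm)
    (hQ : LiesOnQuadric (matrixForm B) (vectorForm b) c ι)
    (hF : ∃ v, matrixForm B v v / 2 + vectorForm b v + c ≠ 0) (hι : IsSmoothImmersion 3 ι) {x : N}
    (hN : IsLocallyStrictlyConvexAt 3 ι x) (y z : TangentSpace (𝓡 3) x) :
    blaschkeMetric ι x y z =
      matrixForm B (diffAt 3 ι x y) (diffAt 3 ι x z) / fifthRoot (quadricInvariant B b c) := by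
  have hιx := hι.1.contMDiffAt (x := x)
  have hg := hQ.gradient_ne_zero hF hι hN
  obtain ⟨k, hk0, hk⟩ := exists_bracket_eq_mul_gradient hι hg fun y => hQ.gradient_diffAt hιx y
  have hH : ∀ y z, hypersurfaceForm ι x (coordFrame x) y z =
      (-k) * matrixForm B (diffAt 3 ι x y) (diffAt 3 ι x z) := fun y z => by
    have h := hQ.gradient_secondDerivAt hιx z y
    rw [hypersurfaceForm, hk, add_apply, h, hQ.symm]
    ring
  have hdet := hQ.det_gram hB (u := fun i => diffAt 3 ι x (coordFrame x i)) hk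
  -- The three powers of `k` from the scaling of the Gram matrix and the two from its determinant give a
  -- fifth power, whose root cancels the factor `-k` of `H`.
  have hdet' : (Matrix.of fun i j : Fin 3 => hypersurfaceForm ι x (coordFrame x)
      (coordFrame x i) (coordFrame x j)).det = (-k) ^ 5 * quadricInvariant B b c := by
    have : (Matrix.of fun i j : Fin 3 => hypersurfaceForm ι x (coordFrame x)
        (coordFrame x i) (coordFrame x j)) = (-k) • Matrix.of fun i j : Fin 3 =>
          matrixForm B (diffAt 3 ι x (coordFrame x i)) (diffAt 3 ι x (coordFrame x j)) := by
      ext i j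
      simp only [Matrix.of_apply, Matrix.smul_apply, hH, smul_eq_mul]
    rw [this, Matrix.det_smul, hdet, Fintype.card_fin]
    ring
  rw [blaschkeMetric, normalizedForm, hdet', hH, fifthRoot_pow_mul (neg_ne_zero.2 hk0),
    mul_div_mul_left _ _ (neg_ne_zero.2 hk0)]

/-- The support form is `m` times the gradient, so that `-m β` is positive definite on the tangent space;
its Gram determinant shows that the invariant has the sign of `-m` too. -/
theorem LiesOnQuadric.scaled_hessian_pos (hB : B.IsSymm)
    (hQ : LiesOnQuadric (matrixForm B) (vectorForm b) c ι)
    (hF : ∃ v, matrixForm B v v / 2 + vectorForm b v + c ≠ 0) (hι : IsSmoothImmersion 3 ι) {x : N}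
    (hN : IsLocallyStrictlyConvexAt 3 ι x) {y : TangentSpace (𝓡 3) x} (hy : y ≠ 0) :
    0 < matrixForm B (diffAt 3 ι x y) (diffAt 3 ι x y) / fifthRoot (quadricInvariant B b c) := by
  have hιx := hι.1.contMDiffAt (x := x)
  have hg := hQ.gradient_ne_zero hF hι hN
  obtain ⟨k, hk0, hk⟩ := exists_bracket_eq_mul_gradient hι hg fun y => hQ.gradient_diffAt hιx y
  obtain ⟨l, -, hlT, hlpos⟩ := hN.exists_conormal hιx
  obtain ⟨m, hm⟩ := exists_eq_smul_of_forall_apply_eq_zero (finrank_tangentSpace x)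
    (A := (diffAt 3 ι x).toLinearMap) (hι.2 x) hg (fun y => hQ.gradient_diffAt hιx y) hlT
  have hpos : ∀ y, y ≠ 0 → 0 < (-m) * matrixForm B (diffAt 3 ι x y) (diffAt 3 ι x y) :=
    fun y hy => by
      have h := hlpos y hy
      rw [hm, add_apply, hQ.gradient_secondDerivAt hιx] at h
      linarith
  have hdet := hQ.det_gram hB (u := fun i => diffAt 3 ι x (coordFrame x i)) hk
  set G : Matrix (Fin 3) (Fin 3) ℝ := Matrix.of fun i j : Fin 3 =>
    matrixForm B (diffAt 3 ι x (coordFrame x i)) (diffAt 3 ι x (coordFrame x j)) with hG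
  have hli : LinearIndependent ℝ (coordFrame x) := linearIndependent_coordFrame x
  have hGpos : ((-m) • G).PosDef := by
    refine Matrix.PosDef.of_dotProduct_mulVec_pos ?_ fun a ha => ?_
    · ext i j
      simp only [Matrix.conjTranspose_apply, Matrix.smul_apply, hG, Matrix.of_apply, star_trivial]
      rw [hQ.symm]
    · have hne : ∑ i, a i • coordFrame x i ≠ 0 := fun h =>
        ha (funext (Fintype.linearIndependent_iff.1 hli a h))
      convert! hpos _ hne using 1
      simp only [map_sum, map_smul, sum_apply, smul_apply, smul_eq_mul,
        dotProduct, Matrix.mulVec, hG, Matrix.smul_apply, Matrix.of_apply, Finset.mul_sum,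
        star_trivial]
      rw [Finset.sum_comm]
      refine Finset.sum_congr rfl fun i _ => Finset.sum_congr rfl fun j _ => ?_
      ring
  have h1 := hGpos.det_pos
  rw [Matrix.det_smul, hdet, Fintype.card_fin] at h1
  have h2 := hpos y hy
  have hk2 : 0 < k ^ 2 := by positivity
  rcases lt_trichotomy m 0 with h | h | h
  · have h3 : 0 < (-m) ^ 3 * k ^ 2 := by
      have : 0 < -m := by linarith
      positivity
    have hC : 0 < quadricInvariant B b c := by
      by_contra hc
      nlinarith [mul_nonneg h3.le (sub_nonneg.2 (not_lt.1 hc))]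
    exact div_pos (by nlinarith) (fifthRoot_pos hC)
  · rw [h] at h2; simp at h2
  · have h3 : 0 < m ^ 3 * k ^ 2 := by positivity
    have hC : 0 < -quadricInvariant B b c := by
      by_contra hc
      nlinarith [mul_nonneg h3.le (sub_nonneg.2 (not_lt.1 hc))]
    have h4 := fifthRoot_pos hC
    rw [fifthRoot_neg] at h4
    exact div_pos_of_neg_of_neg (by nlinarith) (by linarith)

end Blaschke

/-! ### Covariant derivatives of a metric induced by a constant form -/

section DirectionalDerivative

variable {M : Type*} [TopologicalSpace M] [ChartedSpace (RealSpace 2) M]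

/-- The curve through `p` that is a straight line with velocity `x` in the chart at `p`. -/
noncomputable def chartLine (p : M) (x : RealSpace 2) (t : ℝ) : M :=
  (extChartAt (𝓡 2) p).symm (extChartAt (𝓡 2) p p + t • x)

theorem chartLine_zero (p : M) (x : RealSpace 2) : chartLine p x 0 = p := by
  rw [chartLine, zero_smul, add_zero, extChartAt_to_inv]

theorem hasDerivAt_comp_chartLine {F : Type*} [NormedAddCommGroup F] [NormedSpace ℝ F]
    {u : M → F} {p : M} (hu : MDifferentiableAt (𝓡 2) 𝓘(ℝ, F) u p) (x : RealSpace 2) :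
    HasDerivAt (fun t : ℝ => u (chartLine p x t)) (mfderiv (𝓡 2) 𝓘(ℝ, F) u p x : F) 0 := by
  have h1 : DifferentiableAt ℝ (u ∘ (extChartAt (𝓡 2) p).symm) (extChartAt (𝓡 2) p p) := by
    have := hu.differentiableWithinAt_writtenInExtChartAt
    rw [ModelWithCorners.range_eq_univ, differentiableWithinAt_univ] at this
    exact this
  have h2 : mfderiv (𝓡 2) 𝓘(ℝ, F) u p x =
      fderiv ℝ (u ∘ (extChartAt (𝓡 2) p).symm) (extChartAt (𝓡 2) p p) x := by
    rw [hu.mfderiv, ModelWithCorners.range_eq_univ, fderivWithin_univ]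
    rfl
  have h3 : HasFDerivAt (u ∘ (extChartAt (𝓡 2) p).symm)
      (fderiv ℝ (u ∘ (extChartAt (𝓡 2) p).symm) (extChartAt (𝓡 2) p p))
      (extChartAt (𝓡 2) p p + (0 : ℝ) • x) := by
    rw [zero_smul, add_zero]; exact h1.hasFDerivAt
  rw [h2]
  exact h3.comp_hasDerivAt 0 (hasDerivAt_line (extChartAt (𝓡 2) p p) x 0)

theorem hasDerivAt_dirDeriv {u : M → ℝ} {p : M} (hu : MDifferentiableAt (𝓡 2) 𝓘(ℝ, ℝ) u p)
    (x : TangentSpace (𝓡 2) p) :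
    HasDerivAt (fun t : ℝ => u (chartLine p x t)) (dirDeriv u p x) 0 :=
  hasDerivAt_comp_chartLine hu x

theorem hasDerivAt_diffAt {V : M → RealSpace 4} {p : M}
    (hV : MDifferentiableAt (𝓡 2) 𝓘(ℝ, RealSpace 4) V p) (x : TangentSpace (𝓡 2) p) :
    HasDerivAt (fun t : ℝ => V (chartLine p x t)) (diffAt 2 V p x) 0 :=
  hasDerivAt_comp_chartLine hV x

end DirectionalDerivative

section Induced

variable {M : Type*} [TopologicalSpace M] [ChartedSpace (RealSpace 2) M]

/-- The restriction to a surface of a bilinear form on `ℝ⁴`. -/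
noncomputable def inducedMetric (β : RealSpace 4 →L[ℝ] RealSpace 4 →L[ℝ] ℝ) (f : M → RealSpace 4)
    (q : M) (y z : TangentSpace (𝓡 2) q) : ℝ :=
  β (diffAt 2 f q y) (diffAt 2 f q z)

/-- The component in `σ_p` of the derivative `D_x Y`. -/
noncomputable def TransversalPlaneBundle.normalPart {f : M → RealSpace 4}
    (σ : TransversalPlaneBundle f) (Y : (q : M) → TangentSpace (𝓡 2) q) (p : M)
    (x : TangentSpace (𝓡 2) p) : RealSpace 4 :=
  diffAt 2 (fun q => diffAt 2 f q (Y q)) p x - diffAt 2 f p (σ.connection Y p x)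

theorem TransversalPlaneBundle.normalPart_mem {f : M → RealSpace 4}
    (σ : TransversalPlaneBundle f) (Y : (q : M) → TangentSpace (𝓡 2) q) (p : M)
    (x : TangentSpace (𝓡 2) p) : σ.normalPart Y p x ∈ σ.plane p :=
  Classical.choose_spec (σ.exists_tangentPart p _)

theorem TransversalPlaneBundle.diffAt_connection {f : M → RealSpace 4}
    (σ : TransversalPlaneBundle f) (Y : (q : M) → TangentSpace (𝓡 2) q) (p : M)
    (x : TangentSpace (𝓡 2) p) : diffAt 2 f p (σ.connection Y p x) =
      diffAt 2 (fun q => diffAt 2 f q (Y q)) p x - σ.normalPart Y p x := by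
  rw [TransversalPlaneBundle.normalPart]; abel

variable [IsManifold (𝓡 2) ∞ M] {β : RealSpace 4 →L[ℝ] RealSpace 4 →L[ℝ] ℝ} {f : M → RealSpace 4}

theorem mdifferentiableAt_pushforward (hf : IsSmoothImmersion 2 f) {p : M}
    {Y : (q : M) → TangentSpace (𝓡 2) q} (hY : IsSmoothFieldAt Y p) :
    MDifferentiableAt (𝓡 2) 𝓘(ℝ, RealSpace 4) (fun q => diffAt 2 f q (Y q)) p :=
  (contMDiffAt_pushforward hf.1 hY).mdifferentiableAt (by simp)

theorem mdifferentiableAt_inducedMetric (hf : IsSmoothImmersion 2 f) {p : M}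
    {Y Z : (q : M) → TangentSpace (𝓡 2) q} (hY : IsSmoothFieldAt Y p) (hZ : IsSmoothFieldAt Z p) :
    MDifferentiableAt (𝓡 2) 𝓘(ℝ, ℝ) (fun q => inducedMetric β f q (Y q) (Z q)) p := by
  have hβ : Differentiable ℝ fun v : RealSpace 4 × RealSpace 4 => β v.1 v.2 := by fun_prop
  exact hβ.comp_mdifferentiableAt
    ((mdifferentiableAt_pushforward hf hY).prodMk_space (mdifferentiableAt_pushforward hf hZ))

theorem dirDeriv_inducedMetric (hf : IsSmoothImmersion 2 f) {p : M}
    {Y Z : (q : M) → TangentSpace (𝓡 2) q} (hY : IsSmoothFieldAt Y p) (hZ : IsSmoothFieldAt Z p)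
    (x : TangentSpace (𝓡 2) p) :
    dirDeriv (fun q => inducedMetric β f q (Y q) (Z q)) p x =
      β (diffAt 2 (fun q => diffAt 2 f q (Y q)) p x) (diffAt 2 f p (Z p)) +
        β (diffAt 2 f p (Y p)) (diffAt 2 (fun q => diffAt 2 f q (Z q)) p x) := by
  have h1 := hasDerivAt_dirDeriv (mdifferentiableAt_inducedMetric (β := β) hf hY hZ) x
  have h2 := (β.hasFDerivAt.comp_hasDerivAt 0
    (hasDerivAt_diffAt (mdifferentiableAt_pushforward hf hY) x)).clm_apply
      (hasDerivAt_diffAt (mdifferentiableAt_pushforward hf hZ) x)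
  have h3 := h1.unique h2
  have h4 : ∀ W : (q : M) → TangentSpace (𝓡 2) q,
      diffAt 2 f (chartLine p x 0) (W (chartLine p x 0)) = diffAt 2 f p (W p) :=
    fun W => congrArg (fun q => diffAt 2 f q (W q)) (chartLine_zero p x)
  rwa [Function.comp_apply, h4, h4] at h3

/-- The covariant derivative of the restriction of a constant form involves only the components in
`σ` of the derivatives. -/
theorem nablaMetric_inducedMetric (hf : IsSmoothImmersion 2 f) (σ : TransversalPlaneBundle f)
    {p : M} {Y Z : (q : M) → TangentSpace (𝓡 2) q} (hY : IsSmoothFieldAt Y p)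
    (hZ : IsSmoothFieldAt Z p) (x : TangentSpace (𝓡 2) p) :
    nablaMetric (inducedMetric β f) σ p x Y Z =
      β (σ.normalPart Y p x) (diffAt 2 f p (Z p)) + β (diffAt 2 f p (Y p)) (σ.normalPart Z p x) := by
  unfold nablaMetric
  rw [dirDeriv_inducedMetric hf hY hZ, inducedMetric, inducedMetric, σ.diffAt_connection,
    σ.diffAt_connection]
  simp only [map_sub, sub_apply]
  ring

/-- The quotient rule for the area form; the derivative of `√D` for `D = g(A, A) g(B, B) - g(A, B) ^ 2`
is `D' / (2 √D)`. The functions `G` and `G'` abbreviate the inner products of fields at `p` and their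
derivatives along `x`. -/
theorem dirDeriv_metricVolume (hf : IsSmoothImmersion 2 f) {p : M}
    {A B Y Z : (q : M) → TangentSpace (𝓡 2) q} (hA : IsSmoothFieldAt A p)
    (hB : IsSmoothFieldAt B p) (hY : IsSmoothFieldAt Y p) (hZ : IsSmoothFieldAt Z p)
    (hD : 0 < inducedMetric β f p (A p) (A p) * inducedMetric β f p (B p) (B p) -
      inducedMetric β f p (A p) (B p) ^ 2) (x : TangentSpace (𝓡 2) p)
    {G : ((q : M) → TangentSpace (𝓡 2) q) → ((q : M) → TangentSpace (𝓡 2) q) → ℝ}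
    (hG : ∀ V W, G V W = inducedMetric β f p (V p) (W p))
    {G' : ((q : M) → TangentSpace (𝓡 2) q) → ((q : M) → TangentSpace (𝓡 2) q) → ℝ}
    (hG' : ∀ V W, G' V W = dirDeriv (fun q => inducedMetric β f q (V q) (W q)) p x) :
    dirDeriv (fun q => metricVolume (inducedMetric β f q) (A q) (B q) (Y q) (Z q)) p x =
      ((G' A Y * G B Z + G A Y * G' B Z - (G' A Z * G B Y + G A Z * G' B Y)) *
          √(G A A * G B B - G A B ^ 2) -
        (G A Y * G B Z - G A Z * G B Y) *
          ((G' A A * G B B + G A A * G' B B - 2 * G A B * G' A B) /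
            (2 * √(G A A * G B B - G A B ^ 2)))) / √(G A A * G B B - G A B ^ 2) ^ 2 := by
  have hd {V W : (q : M) → TangentSpace (𝓡 2) q} (hV : IsSmoothFieldAt V p)
      (hW : IsSmoothFieldAt W p) : HasDerivAt (fun t : ℝ =>
        inducedMetric β f (chartLine p x t) (V (chartLine p x t)) (W (chartLine p x t)))
          (G' V W) 0 := by
    rw [hG']
    exact hasDerivAt_dirDeriv (mdifferentiableAt_inducedMetric (β := β) hf hV hW) x
  have hm {V W : (q : M) → TangentSpace (𝓡 2) q} (hV : IsSmoothFieldAt V p)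
      (hW : IsSmoothFieldAt W p) := mdifferentiableAt_inducedMetric (β := β) hf hV hW
  have hmd : MDifferentiableAt (𝓡 2) 𝓘(ℝ, ℝ)
      (fun q => metricVolume (inducedMetric β f q) (A q) (B q) (Y q) (Z q)) p := by
    let Φ : ((ℝ × ℝ) × (ℝ × ℝ)) × ((ℝ × ℝ) × ℝ) → ℝ := fun v =>
      (v.1.1.1 * v.1.1.2 - v.1.2.1 * v.1.2.2) / √(v.2.1.1 * v.2.1.2 - v.2.2 ^ 2)
    have hΦ : ∀ v : ((ℝ × ℝ) × (ℝ × ℝ)) × ((ℝ × ℝ) × ℝ),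
        0 < v.2.1.1 * v.2.1.2 - v.2.2 ^ 2 → DifferentiableAt ℝ Φ v := fun v hv => by
      have h1 : DifferentiableAt ℝ (fun v : ((ℝ × ℝ) × (ℝ × ℝ)) × ((ℝ × ℝ) × ℝ) =>
          v.2.1.1 * v.2.1.2 - v.2.2 ^ 2) v := by fun_prop
      have h2 : DifferentiableAt ℝ (fun v : ((ℝ × ℝ) × (ℝ × ℝ)) × ((ℝ × ℝ) × ℝ) =>
          v.1.1.1 * v.1.1.2 - v.1.2.1 * v.1.2.2) v := by fun_prop
      simp only [Φ, div_eq_mul_inv]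
      exact h2.mul ((h1.sqrt hv.ne').inv (Real.sqrt_ne_zero'.2 hv))
    have hu := (((hm hA hY).prodMk_space (hm hB hZ)).prodMk_space
        ((hm hA hZ).prodMk_space (hm hB hY))).prodMk_space
          (((hm hA hA).prodMk_space (hm hB hB)).prodMk_space (hm hA hB))
    exact DifferentiableAt.comp_mdifferentiableAt (hΦ _ hD) hu
  have h1 := hasDerivAt_dirDeriv hmd x
  have hG0 : ∀ V W : (q : M) → TangentSpace (𝓡 2) q, inducedMetric β f (chartLine p x 0)
      (V (chartLine p x 0)) (W (chartLine p x 0)) = G V W := fun V W =>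
    (congrArg (fun q => inducedMetric β f q (V q) (W q)) (chartLine_zero p x)).trans (hG V W).symm
  rw [← hG, ← hG, ← hG] at hD
  have h2 := ((((hd hA hY).mul (hd hB hZ)).sub ((hd hA hZ).mul (hd hB hY))).div
    ((((hd hA hA).mul (hd hB hB)).sub ((hd hA hB).pow 2)).sqrt (by
      simp only [hG0, Pi.sub_apply, Pi.mul_apply, Pi.pow_apply]; exact hD.ne'))
    (Real.sqrt_ne_zero'.2 (by
      simp only [hG0, Pi.sub_apply, Pi.mul_apply, Pi.pow_apply]; exact hD)))
  have h3 := h1.unique h2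
  rw [h3]
  simp only [hG0, Pi.sub_apply, Pi.mul_apply, Pi.pow_apply]
  norm_num

end Induced

/-! ### The orthogonal plane bundle -/

section TangentPlane

variable {M : Type*} [TopologicalSpace M] [ChartedSpace (RealSpace 2) M]
  {β : RealSpace 4 →L[ℝ] RealSpace 4 →L[ℝ] ℝ} {f : M → RealSpace 4}

theorem finrank_tangentPlane (p : M) : Module.finrank ℝ (TangentSpace (𝓡 2) p) = 2 :=
  finrank_euclideanSpace_fin (𝕜 := ℝ) (n := 2)

/-- The restriction of the symmetric form `β` to the surface is positive definite. -/
structure IsPositiveOn (β : RealSpace 4 →L[ℝ] RealSpace 4 →L[ℝ] ℝ) (f : M → RealSpace 4) :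
    Prop where
  symm : ∀ u v, β u v = β v u
  pos : ∀ (q : M) (y : TangentSpace (𝓡 2) q), y ≠ 0 → 0 < β (diffAt 2 f q y) (diffAt 2 f q y)

theorem exists_eq_smul_add_smul {p : M} {a b : TangentSpace (𝓡 2) p}
    (h : LinearIndependent ℝ ![a, b]) (y : TangentSpace (𝓡 2) p) :
    ∃ r s : ℝ, y = r • a + s • b := by
  have : FiniteDimensional ℝ (TangentSpace (𝓡 2) p) :=
    FiniteDimensional.of_finrank_pos (by rw [finrank_tangentPlane]; norm_num)
  have h1 := h.span_eq_top_of_card_eq_finrank (by rw [finrank_tangentPlane]; simp)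
  have h2 : y ∈ Submodule.span ℝ (Set.range ![a, b]) := by rw [h1]; trivial
  rw [Matrix.range_cons, Matrix.range_cons, Matrix.range_empty, Set.union_empty,
    Set.singleton_union, Submodule.mem_span_pair] at h2
  obtain ⟨r, s, h⟩ := h2
  exact ⟨r, s, h.symm⟩

theorem IsPositiveOn.discriminant_pos (hβ : IsPositiveOn β f) {p : M}
    {a b : TangentSpace (𝓡 2) p} (h : LinearIndependent ℝ ![a, b]) :
    0 < β (diffAt 2 f p a) (diffAt 2 f p a) * β (diffAt 2 f p b) (diffAt 2 f p b) -
      β (diffAt 2 f p a) (diffAt 2 f p b) ^ 2 := by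
  have ha : a ≠ 0 := h.ne_zero 0
  have hpa := hβ.pos p a ha
  set A := diffAt 2 f p a with hA
  set B := diffAt 2 f p b with hB
  have hne : β A A • b - β A B • a ≠ 0 := fun h0 => by
    have h1 := LinearIndependent.pair_iff.1 h (-β A B) (β A A) (by rw [← h0]; module)
    exact hpa.ne' h1.2
  have h1 := hβ.pos p _ hne
  rw [map_sub, map_smul, map_smul, ← hA, ← hB] at h1
  have h2 := hβ.symm B A
  simp only [map_sub, map_smul, sub_apply, smul_apply, smul_eq_mul, h2] at h1
  have h3 : 0 < β A A * (β A A * β B B - β A B ^ 2) := by linarith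
  exact (mul_pos_iff_of_pos_left hpa).1 h3

theorem exists_linearIndependent_tangentPlane (p : M) :
    ∃ a b : TangentSpace (𝓡 2) p, LinearIndependent ℝ ![a, b] := by
  have : ∃ a b : RealSpace 2, LinearIndependent ℝ ![a, b] := by
    refine ⟨EuclideanSpace.single 0 1, EuclideanSpace.single 1 1, ?_⟩
    rw [LinearIndependent.pair_iff]
    intro s t h
    have h0 := congrArg (fun v : RealSpace 2 => v 0) h
    have h1 := congrArg (fun v : RealSpace 2 => v 1) h
    simp at h0 h1
    exact ⟨h0, h1⟩
  exact this

/-- The Gram-Schmidt process in a tangent plane. -/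
theorem IsPositiveOn.exists_orthonormal (hβ : IsPositiveOn β f) (p : M) :
    ∃ a b : TangentSpace (𝓡 2) p, LinearIndependent ℝ ![a, b] ∧
      β (diffAt 2 f p a) (diffAt 2 f p a) = 1 ∧ β (diffAt 2 f p a) (diffAt 2 f p b) = 0 ∧
      β (diffAt 2 f p b) (diffAt 2 f p b) = 1 := by
  obtain ⟨a₀, b₀, h⟩ := exists_linearIndependent_tangentPlane p
  have ha : a₀ ≠ 0 := h.ne_zero 0
  have hpa := hβ.pos p a₀ ha
  have hD := hβ.discriminant_pos h
  set A := diffAt 2 f p a₀ with hA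
  set B := diffAt 2 f p b₀ with hB
  set D := β A A * β B B - β A B ^ 2 with hDdef
  have h2 := hβ.symm B A
  set r := √(β A A) with hr
  set s := √(β A A * D) with hs
  have hr2 : r ^ 2 = β A A := Real.sq_sqrt hpa.le
  have hs2 : s ^ 2 = β A A * D := Real.sq_sqrt (mul_pos hpa hD).le
  have hr0 : r ≠ 0 := (Real.sqrt_pos.2 hpa).ne'
  have hs0 : s ≠ 0 := (Real.sqrt_pos.2 (mul_pos hpa hD)).ne'
  have hE1 : diffAt 2 f p (r⁻¹ • a₀) = r⁻¹ • A := map_smul _ _ _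
  have hE2 : diffAt 2 f p (s⁻¹ • (β A A • b₀ - β A B • a₀)) =
      s⁻¹ • (β A A • B - β A B • A) := by rw [map_smul, map_sub, map_smul, map_smul]
  refine ⟨r⁻¹ • a₀, s⁻¹ • (β A A • b₀ - β A B • a₀), ?_, ?_, ?_, ?_⟩
  · rw [LinearIndependent.pair_iff]
    intro u v huv
    have h3 := LinearIndependent.pair_iff.1 h (u * r⁻¹ - v * s⁻¹ * β A B) (v * s⁻¹ * β A A)
      (by rw [← huv]; module)
    have hv : v = 0 := by simpa [hs0, hpa.ne'] using h3.2
    have hu := h3.1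
    rw [hv] at hu
    exact ⟨by simpa [hr0] using hu, hv⟩
  · rw [hE1]
    simp only [map_smul, smul_apply, smul_eq_mul]
    rw [← hr2]; field_simp
  · rw [hE1, hE2]
    simp only [map_smul, map_sub, smul_apply, smul_eq_mul]
    ring
  · rw [hE2]
    simp only [map_smul, map_sub, smul_apply, sub_apply, smul_eq_mul, h2]
    have : β A A * (β A A * β B B) - β A A * (β A B * β A B) = s ^ 2 := by rw [hs2, hDdef]; ring
    field_simp
    linear_combination this

end TangentPlane

section Orthogonal

variable {M : Type*} [TopologicalSpace M] [ChartedSpace (RealSpace 2) M]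
  {β : RealSpace 4 →L[ℝ] RealSpace 4 →L[ℝ] ℝ} {f : M → RealSpace 4}

/-- The orthogonal complement of the tangent plane with respect to the form `β`. -/
def orthogonalPlane (β : RealSpace 4 →L[ℝ] RealSpace 4 →L[ℝ] ℝ) (f : M → RealSpace 4) (p : M) :
    Submodule ℝ (RealSpace 4) where
  carrier := {w | ∀ y, β w (diffAt 2 f p y) = 0}
  add_mem' := fun hu hv y => by rw [map_add, add_apply, hu y, hv y, add_zero]
  zero_mem' := fun y => by rw [map_zero, zero_apply]
  smul_mem' := fun r u hu y => by rw [map_smul, smul_apply, hu y, smul_zero]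

theorem mem_orthogonalPlane_of_basis {p : M} {w : RealSpace 4} {a b : TangentSpace (𝓡 2) p}
    (h : LinearIndependent ℝ ![a, b]) (ha : β w (diffAt 2 f p a) = 0)
    (hb : β w (diffAt 2 f p b) = 0) : w ∈ orthogonalPlane β f p := fun y => by
  obtain ⟨r, s, rfl⟩ := exists_eq_smul_add_smul h y
  rw [map_add, map_smul, map_smul, map_add, map_smul, map_smul, ha, hb]
  simp

theorem IsPositiveOn.isCompl_orthogonalPlane (hβ : IsPositiveOn β f) (p : M) :
    IsCompl (LinearMap.range (diffAt 2 f p).toLinearMap) (orthogonalPlane β f p) := by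
  constructor
  · rw [Submodule.disjoint_def]
    rintro _ ⟨y, rfl⟩ hy
    by_contra hne
    have hy0 : y ≠ 0 := fun h => hne (by rw [h, map_zero])
    exact (hβ.pos p y hy0).ne' (hy y)
  · rw [codisjoint_iff, eq_top_iff]
    intro w _
    obtain ⟨a, b, hli, haa, hab, hbb⟩ := hβ.exists_orthonormal p
    have hba := hab
    rw [hβ.symm] at hba
    set A := diffAt 2 f p a with hA
    set B := diffAt 2 f p b with hB
    refine Submodule.mem_sup.2 ⟨diffAt 2 f p (β w A • a + β w B • b), ⟨_, rfl⟩,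
      w - diffAt 2 f p (β w A • a + β w B • b), ?_, by abel⟩
    rw [map_add, map_smul, map_smul, ← hA, ← hB]
    refine mem_orthogonalPlane_of_basis hli ?_ ?_
    · rw [← hA]
      simp only [map_sub, map_add, map_smul, sub_apply, add_apply, smul_apply, smul_eq_mul, haa, hba]
      ring
    · rw [← hB]
      simp only [map_sub, map_add, map_smul, sub_apply, add_apply, smul_apply, smul_eq_mul, hab, hbb]
      ring

theorem finrank_plane (hinj : ∀ p, Function.Injective (diffAt 2 f p)) {p : M}
    {S : Submodule ℝ (RealSpace 4)}
    (h : IsCompl (LinearMap.range (diffAt 2 f p).toLinearMap) S) : Module.finrank ℝ S = 2 := by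
  have h1 := Submodule.finrank_add_eq_of_isCompl h
  have h2 : Module.finrank ℝ (LinearMap.range (diffAt 2 f p).toLinearMap) = 2 := by
    rw [LinearMap.finrank_range_of_inj (hinj p), finrank_tangentPlane]
  have h3 : Module.finrank ℝ (RealSpace 4) = 4 := by simp
  omega

variable [IsManifold (𝓡 2) ∞ M]

/-- A smooth local frame of the orthogonal planes: the projections of a basis of the plane at `p`. -/
theorem IsPositiveOn.exists_frame_orthogonalPlane (hβ : IsPositiveOn β f)
    (hf : IsSmoothImmersion 2 f) (p : M) : ∃ ξ₁ ξ₂ : M → RealSpace 4,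
      ContMDiffAt (𝓡 2) 𝓘(ℝ, RealSpace 4) ∞ ξ₁ p ∧
      ContMDiffAt (𝓡 2) 𝓘(ℝ, RealSpace 4) ∞ ξ₂ p ∧
      ∀ᶠ q in 𝓝 p, orthogonalPlane β f q = Submodule.span ℝ {ξ₁ q, ξ₂ q} := by
  obtain ⟨a, b, hli⟩ := exists_linearIndependent_tangentPlane p
  set Y := constField a
  set Z := constField b
  have hYp : Y p = a := FiberBundle.extend_apply_self _ a
  have hZp : Z p = b := FiberBundle.extend_apply_self _ b
  have hV := contMDiffAt_pushforward hf.1 (isSmoothFieldAt_constField a)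
  have hW := contMDiffAt_pushforward hf.1 (isSmoothFieldAt_constField b)
  set V : M → RealSpace 4 := fun q => diffAt 2 f q (Y q) with hVdef
  set W : M → RealSpace 4 := fun q => diffAt 2 f q (Z q) with hWdef
  -- Cramer's rule for the orthogonal projection, multiplied by the Gram determinant.
  let Φ : RealSpace 4 → RealSpace 4 × RealSpace 4 → RealSpace 4 := fun w v =>
    (β v.1 v.1 * β v.2 v.2 - β v.1 v.2 ^ 2) • w
      - (β v.2 v.2 * β w v.1 - β v.1 v.2 * β w v.2) • v.1
      - (β v.1 v.1 * β w v.2 - β v.1 v.2 * β w v.1) • v.2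
  have hΦ : ∀ w, ContDiff ℝ ∞ (Φ w) := fun w => by
    have h1 : ContDiff ℝ ∞ fun v : RealSpace 4 × RealSpace 4 => β v.1 v.1 := by fun_prop
    have h2 : ContDiff ℝ ∞ fun v : RealSpace 4 × RealSpace 4 => β v.2 v.2 := by fun_prop
    have h3 : ContDiff ℝ ∞ fun v : RealSpace 4 × RealSpace 4 => β v.1 v.2 := by fun_prop
    fun_prop
  have hξ : ∀ w, ContMDiffAt (𝓡 2) 𝓘(ℝ, RealSpace 4) ∞ (fun q => Φ w (V q, W q)) p := fun w =>
    (hΦ w).contMDiff.contMDiffAt.comp p (hV.prodMk_space hW)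
  have hfr := finrank_plane hf.2 (hβ.isCompl_orthogonalPlane p)
  have : Module.Free ℝ (orthogonalPlane β f p) := inferInstance
  let e := Module.finBasisOfFinrankEq ℝ (orthogonalPlane β f p) hfr
  have hV1 : ∀ᶠ q in 𝓝 p, LinearIndependent ℝ ![V q, W q] := by
    have h0 : LinearIndependent ℝ ![V p, W p] := by
      have := hli.map' (diffAt 2 f p).toLinearMap (LinearMap.ker_eq_bot.2 (hf.2 p))
      convert! this using 1
      ext i
      fin_cases i <;> simp [hVdef, hWdef, hYp, hZp]
    have hc : ContinuousAt (fun q => ![V q, W q]) p := by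
      rw [continuousAt_pi]
      intro i
      fin_cases i
      · exact hV.continuousAt
      · exact hW.continuousAt
    exact hc.eventually (isOpen_setOfPred_linearIndependent.mem_nhds h0)
  have hE : ∀ᶠ q in 𝓝 p, LinearIndependent ℝ ![Φ (e 0) (V q, W q), Φ (e 1) (V q, W q)] := by
    have h0 : LinearIndependent ℝ ![Φ (e 0) (V p, W p), Φ (e 1) (V p, W p)] := by
      have hD := hβ.discriminant_pos hli
      have hΦe : ∀ i, Φ (e i) (V p, W p) = (β (diffAt 2 f p a) (diffAt 2 f p a) *
          β (diffAt 2 f p b) (diffAt 2 f p b) - β (diffAt 2 f p a) (diffAt 2 f p b) ^ 2) •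
            (e i : RealSpace 4) := fun i => by
        have hVp : V p = diffAt 2 f p a := by rw [← hYp]
        have hWp : W p = diffAt 2 f p b := by rw [← hZp]
        have h1 : β (e i : RealSpace 4) (diffAt 2 f p a) = 0 := (e i).2 a
        have h2 : β (e i : RealSpace 4) (diffAt 2 f p b) = 0 := (e i).2 b
        simp only [Φ, hVp, hWp, h1, h2]
        simp
      have h3 := e.linearIndependent.map' (orthogonalPlane β f p).subtype (Submodule.ker_subtype _)
      have h4 := h3.units_smul fun _ => Units.mk0 _ hD.ne'
      convert! h4 using 1
      funext i
      fin_cases i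
      · exact hΦe 0
      · exact hΦe 1
    have hc : ContinuousAt (fun q => ![Φ (e 0) (V q, W q), Φ (e 1) (V q, W q)]) p := by
      rw [continuousAt_pi]
      intro i
      fin_cases i
      · exact (hξ _).continuousAt
      · exact (hξ _).continuousAt
    exact hc.eventually (isOpen_setOfPred_linearIndependent.mem_nhds h0)
  refine ⟨_, _, hξ (e 0), hξ (e 1), ?_⟩
  filter_upwards [hV1, hE] with q hq1 hq2
  have hYZ : LinearIndependent ℝ ![Y q, Z q] := by
    refine LinearIndependent.of_comp (diffAt 2 f q).toLinearMap ?_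
    convert! hq1 using 1
    ext i
    fin_cases i <;> rfl
  have hmem : ∀ w, Φ w (V q, W q) ∈ orthogonalPlane β f q := fun w => by
    have hs := hβ.symm (W q) (V q)
    refine mem_orthogonalPlane_of_basis hYZ ?_ ?_
    · change β _ (V q) = 0
      simp only [Φ, map_sub, map_smul, sub_apply, smul_apply, smul_eq_mul, hs]
      ring
    · change β _ (W q) = 0
      simp only [Φ, map_sub, map_smul, sub_apply, smul_apply, smul_eq_mul]
      ring
  have hle : Submodule.span ℝ {Φ (e 0) (V q, W q), Φ (e 1) (V q, W q)} ≤
      orthogonalPlane β f q := by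
    rw [Submodule.span_le]
    rintro _ (rfl | rfl)
    · exact hmem _
    · exact hmem _
  refine (Submodule.eq_of_le_of_finrank_eq hle ?_).symm
  rw [finrank_plane hf.2 (hβ.isCompl_orthogonalPlane q)]
  have := finrank_span_eq_card hq2
  rw [Matrix.range_cons, Matrix.range_cons, Matrix.range_empty, Set.union_empty,
    Set.singleton_union] at this
  simpa using this

/-- The bundle of the orthogonal complements of the tangent planes for the form `β`. -/
noncomputable def orthogonalBundle (hβ : IsPositiveOn β f) (hf : IsSmoothImmersion 2 f) :
    TransversalPlaneBundle f where
  plane := orthogonalPlane β f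
  isCompl := hβ.isCompl_orthogonalPlane
  smooth := hβ.exists_frame_orthogonalPlane hf

end Orthogonal

/-! ### Existence and uniqueness of the equiaffine plane bundle -/

section Existence

variable {M : Type*} [TopologicalSpace M] [ChartedSpace (RealSpace 2) M] [IsManifold (𝓡 2) ∞ M]
  {β : RealSpace 4 →L[ℝ] RealSpace 4 →L[ℝ] ℝ} {f : M → RealSpace 4}

theorem inner_normalPart_orthogonalBundle (hβ : IsPositiveOn β f) (hf : IsSmoothImmersion 2 f)
    (Y : (q : M) → TangentSpace (𝓡 2) q) (p : M) (x y : TangentSpace (𝓡 2) p) :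
    β ((orthogonalBundle hβ hf).normalPart Y p x) (diffAt 2 f p y) = 0 :=
  (orthogonalBundle hβ hf).normalPart_mem Y p x y

/-- The connection of the orthogonal bundle is metric. -/
theorem nablaMetric_orthogonalBundle (hβ : IsPositiveOn β f) (hf : IsSmoothImmersion 2 f)
    {p : M} {Y Z : (q : M) → TangentSpace (𝓡 2) q} (hY : IsSmoothFieldAt Y p)
    (hZ : IsSmoothFieldAt Z p) (x : TangentSpace (𝓡 2) p) :
    nablaMetric (inducedMetric β f) (orthogonalBundle hβ hf) p x Y Z = 0 := by
  rw [nablaMetric_inducedMetric hf _ hY hZ, inner_normalPart_orthogonalBundle, hβ.symm,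
    inner_normalPart_orthogonalBundle, add_zero]

theorem isEquiaffine_orthogonalBundle (hβ : IsPositiveOn β f) (hf : IsSmoothImmersion 2 f) :
    IsEquiaffine (inducedMetric β f) (orthogonalBundle hβ hf) := by
  intro p A B hA hB hli x Y Z hY hZ
  set σ := orthogonalBundle hβ hf with hσ
  have hD := hβ.discriminant_pos hli
  have hG' : ∀ {V W : (q : M) → TangentSpace (𝓡 2) q}, IsSmoothFieldAt V p → IsSmoothFieldAt W p →
      dirDeriv (fun q => inducedMetric β f q (V q) (W q)) p x =
        inducedMetric β f p (σ.connection V p x) (W p) +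
          inducedMetric β f p (V p) (σ.connection W p x) := fun hV hW => by
    have := nablaMetric_orthogonalBundle hβ hf hV hW x
    rw [nablaMetric] at this
    linarith
  rw [nablaVolume, dirDeriv_metricVolume hf hA hB hY hZ hD x (fun _ _ => rfl) (fun _ _ => rfl),
    hG' hA hY, hG' hB hZ, hG' hA hZ, hG' hB hY, hG' hA hA, hG' hB hB, hG' hA hB]
  obtain ⟨r, s, hrs⟩ := exists_eq_smul_add_smul hli (σ.connection A p x)
  obtain ⟨r', s', hrs'⟩ := exists_eq_smul_add_smul hli (σ.connection B p x)
  have hlin : ∀ (r s : ℝ) (w : TangentSpace (𝓡 2) p),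
      inducedMetric β f p (r • A p + s • B p) w =
        r * inducedMetric β f p (A p) w + s * inducedMetric β f p (B p) w := fun r s w => by
    simp only [inducedMetric, map_add, map_smul, add_apply, smul_apply, smul_eq_mul]
  have hsymm : ∀ v w : TangentSpace (𝓡 2) p, inducedMetric β f p v w = inducedMetric β f p w v :=
    fun v w => hβ.symm _ _
  rw [hsymm (A p) (σ.connection A p x), hsymm (B p) (σ.connection B p x),
    hsymm (A p) (σ.connection B p x), hrs, hrs']
  simp only [hlin]
  unfold metricVolume
  rw [hsymm (B p) (A p)]
  change 0 < inducedMetric β f p (A p) (A p) * inducedMetric β f p (B p) (B p) -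
      inducedMetric β f p (A p) (B p) ^ 2 at hD
  generalize inducedMetric β f p (A p) (A p) = aa at *
  generalize inducedMetric β f p (A p) (B p) = ab at *
  generalize inducedMetric β f p (B p) (B p) = bb at *
  have hS2 := Real.sq_sqrt hD.le
  have hS0 := (Real.sqrt_pos.2 hD).ne'
  generalize √(aa * bb - ab ^ 2) = S at *
  have hab : aa * bb = S ^ 2 + ab ^ 2 := by rw [hS2]; ring
  -- The trace of the connection in the frame `(A, B)` is `D' / (2 D)`.
  have hD' : (r * aa + s * ab + (r * aa + s * ab)) * bb + aa * (r' * ab + s' * bb + (r' * ab + s' * bb))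
      - 2 * ab * (r * ab + s * bb + (r' * aa + s' * ab)) = 2 * (r + s') * S ^ 2 := by
    rw [hS2]; ring
  rw [hD']
  field_simp
  ring

theorem isSymmetricEquiaffine_orthogonalBundle (hβ : IsPositiveOn β f)
    (hf : IsSmoothImmersion 2 f) :
    IsSymmetricEquiaffine (inducedMetric β f) (orthogonalBundle hβ hf) := by
  refine ⟨isEquiaffine_orthogonalBundle hβ hf, fun p X₁ X₂ ⟨h₁, h₂, _⟩ => ?_⟩
  simp [nablaMetric_orthogonalBundle hβ hf, h₁, h₂]

theorem isAntisymmetricEquiaffine_orthogonalBundle (hβ : IsPositiveOn β f)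
    (hf : IsSmoothImmersion 2 f) :
    IsAntisymmetricEquiaffine (inducedMetric β f) (orthogonalBundle hβ hf) := by
  refine ⟨isEquiaffine_orthogonalBundle hβ hf, fun p X₁ X₂ ⟨h₁, h₂, _⟩ => ?_⟩
  simp [nablaMetric_orthogonalBundle hβ hf, h₁, h₂]

end Existence

section Uniqueness

theorem clm_apply_combination {E G : Type*} [NormedAddCommGroup E] [NormedSpace ℝ E]
    [NormedAddCommGroup G] [NormedSpace ℝ G] (D : E →L[ℝ] E →L[ℝ] G) (a b : E) (r s r' s' : ℝ) :
    D (r • a + s • b) (r' • a + s' • b) =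
      (r * r') • D a a + (r * s') • D a b + (s * r') • D b a + (s * s') • D b b := by
  simp only [map_add, map_smul, add_apply, smul_apply]
  module

/-- A linear map `ℝ⁴ → ℝ²` that takes linearly independent values has no other null vectors than those
of a plane on which it vanishes. -/
theorem mem_of_apply_eq_zero {T : Submodule ℝ (RealSpace 4)} (hT : Module.finrank ℝ T = 2)
    {K : RealSpace 4 →ₗ[ℝ] ℝ × ℝ} (hKT : ∀ w ∈ T, K w = 0) {u v w : RealSpace 4}
    (huv : (K u).1 * (K v).2 - (K u).2 * (K v).1 ≠ 0) (hw : K w = 0) : w ∈ T := by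
  have hsurj : Function.Surjective K := fun ⟨s, t⟩ => by
    refine ⟨((K u).1 * (K v).2 - (K u).2 * (K v).1)⁻¹ •
      ((s * (K v).2 - t * (K v).1) • u + (t * (K u).1 - s * (K u).2) • v), ?_⟩
    rw [map_smul, map_add, map_smul, map_smul]
    ext
    · simp only [Prod.smul_fst, Prod.fst_add, smul_eq_mul]
      field_simp
      ring
    · simp only [Prod.smul_snd, Prod.snd_add, smul_eq_mul]
      field_simp
      ring
  have h1 := LinearMap.finrank_range_add_finrank_ker K
  rw [LinearMap.range_eq_top.2 hsurj, finrank_top] at h1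
  have h2 : Module.finrank ℝ (ℝ × ℝ) = 2 := by simp
  have h3 : Module.finrank ℝ (RealSpace 4) = 4 := by simp
  have hle : T ≤ LinearMap.ker K := fun w hw => hKT w hw
  rw [Submodule.eq_of_le_of_finrank_eq hle (by omega)]
  exact hw

variable {M : Type*} [TopologicalSpace M] [ChartedSpace (RealSpace 2) M]
  {β : RealSpace 4 →L[ℝ] RealSpace 4 →L[ℝ] ℝ} {f : M → RealSpace 4}

theorem secondDerivAt_combination {p : M} (hf : ContMDiffAt (𝓡 2) 𝓘(ℝ, RealSpace 4) ∞ f p)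
    (a b : TangentSpace (𝓡 2) p) (r s r' s' : ℝ) :
    secondDerivAt 2 f p (r • a + s • b) (r' • a + s' • b) =
      (r * r') • secondDerivAt 2 f p a a + (r * s') • secondDerivAt 2 f p a b +
        (s * r') • secondDerivAt 2 f p b a + (s * s') • secondDerivAt 2 f p b b := by
  simp only [secondDerivAt_eq hf]
  exact clm_apply_combination (E := RealSpace 2) _ a b r s r' s'

/-- The projection onto `τ_p` along the tangent plane. -/
noncomputable def TransversalPlaneBundle.projection (τ : TransversalPlaneBundle f) (p : M) :
    RealSpace 4 →ₗ[ℝ] RealSpace 4 :=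
  (τ.plane p).subtype ∘ₗ (τ.plane p).projectionOnto _ (τ.isCompl p).symm

theorem TransversalPlaneBundle.projection_diffAt (τ : TransversalPlaneBundle f) (p : M)
    (y : TangentSpace (𝓡 2) p) : τ.projection p (diffAt 2 f p y) = 0 := by
  have h := Submodule.projectionOnto_apply_right (τ.isCompl p).symm
    ⟨diffAt 2 f p y, ⟨y, rfl⟩⟩
  exact (congrArg (τ.plane p).subtype h).trans (map_zero _)

theorem TransversalPlaneBundle.projection_of_mem (τ : TransversalPlaneBundle f) {p : M}
    {w : RealSpace 4} (hw : w ∈ τ.plane p) : τ.projection p w = w := by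
  have h := Submodule.projectionOnto_apply_left (τ.isCompl p).symm ⟨w, hw⟩
  exact congrArg (τ.plane p).subtype h

/-- At a point that is not an inflection, a plane that satisfies the linear conditions of an equiaffine
bundle that is symmetric (`ε = 1`) or antisymmetric (`ε = -3`) is orthogonal to the tangent plane. These
conditions leave two free components `u` and `v` of the difference from the orthogonal connection. If they
are not both zero, the null space of `K` is the tangent plane, although `K` annihilates a combination of
the values of the second fundamental form that the conormal `l` does not annihilate. -/
theorem plane_eq_orthogonalPlane {τ : TransversalPlaneBundle f} (hβ : IsPositiveOn β f)
    (hf : IsSmoothImmersion 2 f) {p : M} {l : RealSpace 4 →L[ℝ] ℝ} {κ : ℝ} (hκ : κ ≠ 0)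
    (hlT : ∀ y, l (diffAt 2 f p y) = 0)
    (hl : ∀ y z, l (secondDerivAt 2 f p z y) = κ * β (diffAt 2 f p z) (diffAt 2 f p y))
    (hp : ¬ IsInflection 2 f p) {a b : TangentSpace (𝓡 2) p} (hli : LinearIndependent ℝ ![a, b])
    (haa : β (diffAt 2 f p a) (diffAt 2 f p a) = 1)
    (hab : β (diffAt 2 f p a) (diffAt 2 f p b) = 0)
    (hbb : β (diffAt 2 f p b) (diffAt 2 f p b) = 1)
    (htr : ∀ x, β (τ.projection p (secondDerivAt 2 f p x a)) (diffAt 2 f p a) +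
      β (τ.projection p (secondDerivAt 2 f p x b)) (diffAt 2 f p b) = 0) {ε : ℝ} (hε : 1 + ε ≠ 0)
    (hε₁ : β (τ.projection p (secondDerivAt 2 f p a a)) (diffAt 2 f p b) =
      ε * β (τ.projection p (secondDerivAt 2 f p a b)) (diffAt 2 f p a))
    (hε₂ : β (τ.projection p (secondDerivAt 2 f p b b)) (diffAt 2 f p a) =
      ε * β (τ.projection p (secondDerivAt 2 f p a b)) (diffAt 2 f p b)) :
    τ.plane p = orthogonalPlane β f p := by
  have hfp := hf.1.contMDiffAt (x := p)
  have hcomm : secondDerivAt 2 f p b a = secondDerivAt 2 f p a b := secondDerivAt_comm hfp b a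
  let K : RealSpace 4 →ₗ[ℝ] ℝ × ℝ :=
    ((β.flip (diffAt 2 f p a)).toLinearMap ∘ₗ τ.projection p).prod
      ((β.flip (diffAt 2 f p b)).toLinearMap ∘ₗ τ.projection p)
  have hK : ∀ w, K w = (β (τ.projection p w) (diffAt 2 f p a),
    β (τ.projection p w) (diffAt 2 f p b)) := fun w => rfl
  have hKT : ∀ w ∈ LinearMap.range (diffAt 2 f p).toLinearMap, K w = 0 := by
    rintro _ ⟨y, rfl⟩
    have : τ.projection p ((diffAt 2 f p).toLinearMap y) = 0 := τ.projection_diffAt p y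
    rw [hK, this]
    simp
  set u := β (τ.projection p (secondDerivAt 2 f p a b)) (diffAt 2 f p a) with hu
  set v := β (τ.projection p (secondDerivAt 2 f p a b)) (diffAt 2 f p b) with hv
  have htra := htr a
  have htrb := htr b
  rw [hcomm] at htrb
  have Kaa : K (secondDerivAt 2 f p a a) = (-v, ε * u) := by
    rw [hK, hε₁]; ext
    · change β _ _ = -v
      linarith
    · rfl
  have Kab : K (secondDerivAt 2 f p a b) = (u, v) := rfl
  have Kbb : K (secondDerivAt 2 f p b b) = (ε * v, -u) := by
    rw [hK, hε₂]; ext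
    · rfl
    · change β _ _ = -u
      linarith
  have huv : u ^ 2 + v ^ 2 = 0 := by
    by_contra hne
    -- The coefficients of the linear relation between the three values of `K`.
    set r := -u ^ 2 - ε * v ^ 2 with hr
    set s := (ε ^ 2 - 1) * (u * v) with hs
    set t := -v ^ 2 - ε * u ^ 2 with ht
    have hrt : r + t ≠ 0 := by
      have : r + t = -((1 + ε) * (u ^ 2 + v ^ 2)) := by rw [hr, ht]; ring
      rw [this]
      exact neg_ne_zero.2 (mul_ne_zero hε hne)
    set w := r • secondDerivAt 2 f p a a + s • secondDerivAt 2 f p a b +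
      t • secondDerivAt 2 f p b b with hw
    have hKw : K w = 0 := by
      rw [hw, map_add, map_add, map_smul, map_smul, map_smul, Kaa, Kab, Kbb]
      ext
      · simp [hr, hs, ht]; ring
      · simp [hr, hs, ht]; ring
    have hlw : l w ≠ 0 := by
      rw [hw, map_add, map_add, map_smul, map_smul, map_smul, hl, hl, hl, haa, hab, hbb]
      have : r • (κ * 1) + s • (κ * 0) + t • (κ * 1) = κ * (r + t) := by
        simp only [smul_eq_mul]; ring
      rw [this]
      exact mul_ne_zero hκ hrt
    have hfr : Module.finrank ℝ (LinearMap.range (diffAt 2 f p).toLinearMap) = 2 := by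
      rw [LinearMap.finrank_range_of_inj (hf.2 p), finrank_tangentPlane]
    have hwT : w ∈ LinearMap.range (diffAt 2 f p).toLinearMap := by
      by_cases h0 : r = 0
      · have ht0 : t ≠ 0 := fun h => hrt (by rw [h0, h, add_zero])
        refine mem_of_apply_eq_zero hfr hKT (u := secondDerivAt 2 f p a a)
          (v := secondDerivAt 2 f p a b) ?_ hKw
        rw [Kaa, Kab]
        convert! ht0 using 1
        simp only [ht]; ring
      · refine mem_of_apply_eq_zero hfr hKT (u := secondDerivAt 2 f p a b)
          (v := secondDerivAt 2 f p b b) ?_ hKw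
        rw [Kab, Kbb]
        convert! h0 using 1
        simp only [hr]; ring
    obtain ⟨y, hy⟩ := hwT
    exact hlw (by rw [← hy]; exact hlT y)
  have hu0 : u = 0 := by nlinarith [sq_nonneg u, sq_nonneg v]
  have hv0 : v = 0 := by nlinarith [sq_nonneg u, sq_nonneg v]
  have hKD : ∀ y z, K (secondDerivAt 2 f p z y) = 0 := fun y z => by
    obtain ⟨r', s', rfl⟩ := exists_eq_smul_add_smul hli y
    obtain ⟨r, s, rfl⟩ := exists_eq_smul_add_smul hli z
    rw [secondDerivAt_combination hfp, hcomm]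
    simp only [map_add, map_smul, Kaa, Kab, Kbb, hu0, hv0]
    simp
  have hK0 : ∀ m : ℝ × ℝ →ₗ[ℝ] ℝ, ∀ w, m (K w) = 0 := fun m w => by
    by_contra hne
    refine hp ⟨LinearMap.toContinuousLinearMap (m ∘ₗ K), fun h => hne ?_, fun y => ?_,
      fun y z => ?_⟩
    · exact congrArg (fun L : RealSpace 4 →L[ℝ] ℝ => L w) h
    · change m (K (diffAt 2 f p y)) = 0
      exact (congrArg m (hKT _ ⟨y, rfl⟩)).trans (map_zero m)
    · change m (K (secondDerivAt 2 f p z y)) = 0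
      rw [hKD, map_zero]
  have hle : τ.plane p ≤ orthogonalPlane β f p := fun w hw => by
    have h1 := hK0 (LinearMap.fst ℝ ℝ ℝ) w
    have h2 := hK0 (LinearMap.snd ℝ ℝ ℝ) w
    rw [hK, τ.projection_of_mem hw] at h1 h2
    exact mem_orthogonalPlane_of_basis hli h1 h2
  refine Submodule.eq_of_le_of_finrank_eq hle ?_
  rw [finrank_plane hf.2 (τ.isCompl p), finrank_plane hf.2 (hβ.isCompl_orthogonalPlane p)]

variable [IsManifold (𝓡 2) ∞ M]

theorem TransversalPlaneBundle.normalPart_constField (τ : TransversalPlaneBundle f)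
    (hf : IsSmoothImmersion 2 f) {p : M} (x y : TangentSpace (𝓡 2) p) :
    τ.normalPart (constField y) p x = τ.projection p (secondDerivAt 2 f p x y) := by
  have h := τ.diffAt_connection (constField y) p x
  rw [diffAt_pushforward_constField hf.1] at h
  have h1 : secondDerivAt 2 f p x y = diffAt 2 f p (τ.connection (constField y) p x) +
      τ.normalPart (constField y) p x := by rw [h]; abel
  rw [h1, map_add, τ.projection_diffAt, τ.projection_of_mem (τ.normalPart_mem _ _ _), zero_add]

/-- In an orthonormal frame the equiaffine condition says that the difference between the induced
connection and the orthogonal one is trace-free. -/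
theorem IsEquiaffine.trace_eq_zero {τ : TransversalPlaneBundle f} (hf : IsSmoothImmersion 2 f)
    (hsymm : ∀ u v, β u v = β v u) (hτ : IsEquiaffine (inducedMetric β f) τ) {p : M}
    {a b : TangentSpace (𝓡 2) p} (hli : LinearIndependent ℝ ![a, b])
    (haa : β (diffAt 2 f p a) (diffAt 2 f p a) = 1)
    (hab : β (diffAt 2 f p a) (diffAt 2 f p b) = 0)
    (hbb : β (diffAt 2 f p b) (diffAt 2 f p b) = 1) (x : TangentSpace (𝓡 2) p) :
    β (τ.projection p (secondDerivAt 2 f p x a)) (diffAt 2 f p a) +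
      β (τ.projection p (secondDerivAt 2 f p x b)) (diffAt 2 f p b) = 0 := by
  have hA := isSmoothFieldAt_constField a
  have hB := isSmoothFieldAt_constField b
  have hAp : constField a p = a := FiberBundle.extend_apply_self _ a
  have hBp : constField b p = b := FiberBundle.extend_apply_self _ b
  have gaa : inducedMetric β f p a a = 1 := haa
  have gab : inducedMetric β f p a b = 0 := hab
  have gba : inducedMetric β f p b a = 0 := (hsymm _ _).trans hab
  have gbb : inducedMetric β f p b b = 1 := hbb
  have h := hτ p (constField a) (constField b) hA hB (by rw [hAp, hBp]; exact hli) x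
    (constField a) (constField b) hA hB
  rw [nablaVolume, dirDeriv_metricVolume hf hA hB hA hB
    (by rw [hAp, hBp, gaa, gab, gbb]; norm_num) x (fun _ _ => rfl) (fun _ _ => rfl),
    dirDeriv_inducedMetric hf hA hA, dirDeriv_inducedMetric hf hB hB] at h
  simp only [hAp, hBp, gaa, gab, gba, gbb, metricVolume,
    diffAt_pushforward_constField hf.1] at h
  simp only [inducedMetric, τ.diffAt_connection, τ.normalPart_constField hf,
    diffAt_pushforward_constField hf.1, map_sub] at h
  have e1 := hsymm (secondDerivAt 2 f p x a) (diffAt 2 f p a)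
  have e2 := hsymm (secondDerivAt 2 f p x b) (diffAt 2 f p b)
  have e3 := hsymm (τ.projection p (secondDerivAt 2 f p x a)) (diffAt 2 f p a)
  have e4 := hsymm (τ.projection p (secondDerivAt 2 f p x b)) (diffAt 2 f p b)
  norm_num at h
  linarith

theorem isOrthonormalAt_constField {p : M} {a b : TangentSpace (𝓡 2) p}
    (haa : β (diffAt 2 f p a) (diffAt 2 f p a) = 1)
    (hab : β (diffAt 2 f p a) (diffAt 2 f p b) = 0)
    (hbb : β (diffAt 2 f p b) (diffAt 2 f p b) = 1) :
    IsOrthonormalAt (inducedMetric β f) (constField a) (constField b) p := by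
  refine ⟨isSmoothFieldAt_constField a, isSmoothFieldAt_constField b, ?_⟩
  have hAp : constField a p = a := FiberBundle.extend_apply_self _ a
  have hBp : constField b p = b := FiberBundle.extend_apply_self _ b
  rw [hAp, hBp]
  exact ⟨haa, hab, hbb⟩

theorem nablaMetric_constField {τ : TransversalPlaneBundle f} (hf : IsSmoothImmersion 2 f)
    (hsymm : ∀ u v, β u v = β v u) {p : M} (x y z : TangentSpace (𝓡 2) p) :
    nablaMetric (inducedMetric β f) τ p x (constField y) (constField z) =
      β (τ.projection p (secondDerivAt 2 f p x y)) (diffAt 2 f p z) +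
        β (τ.projection p (secondDerivAt 2 f p x z)) (diffAt 2 f p y) := by
  have hYp : constField y p = y := FiberBundle.extend_apply_self _ y
  have hZp : constField z p = z := FiberBundle.extend_apply_self _ z
  rw [nablaMetric_inducedMetric hf τ (isSmoothFieldAt_constField y) (isSmoothFieldAt_constField z),
    τ.normalPart_constField hf, τ.normalPart_constField hf, hYp, hZp, hsymm (diffAt 2 f p y)]

theorem IsSymmetricEquiaffine.plane_eq {τ : TransversalPlaneBundle f} (hβ : IsPositiveOn β f)
    (hf : IsSmoothImmersion 2 f) (hτ : IsSymmetricEquiaffine (inducedMetric β f) τ) {p : M}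
    {l : RealSpace 4 →L[ℝ] ℝ} {κ : ℝ} (hκ : κ ≠ 0) (hlT : ∀ y, l (diffAt 2 f p y) = 0)
    (hl : ∀ y z, l (secondDerivAt 2 f p z y) = κ * β (diffAt 2 f p z) (diffAt 2 f p y))
    (hp : ¬ IsInflection 2 f p) : τ.plane p = orthogonalPlane β f p := by
  obtain ⟨a, b, hli, haa, hab, hbb⟩ := hβ.exists_orthonormal p
  obtain ⟨h1, h2⟩ := hτ.2 p _ _ (isOrthonormalAt_constField haa hab hbb)
  have hAp : constField a p = a := FiberBundle.extend_apply_self _ a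
  have hBp : constField b p = b := FiberBundle.extend_apply_self _ b
  simp only [hAp, hBp, nablaMetric_constField hf hβ.symm,
    secondDerivAt_comm (hf.1.contMDiffAt (x := p)) b a] at h1 h2
  exact plane_eq_orthogonalPlane hβ hf hκ hlT hl hp hli haa hab hbb
    (hτ.1.trace_eq_zero hf hβ.symm hli haa hab hbb) (ε := 1) (by norm_num) (by linarith)
    (by linarith)

theorem IsAntisymmetricEquiaffine.plane_eq {τ : TransversalPlaneBundle f} (hβ : IsPositiveOn β f)
    (hf : IsSmoothImmersion 2 f) (hτ : IsAntisymmetricEquiaffine (inducedMetric β f) τ) {p : M}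
    {l : RealSpace 4 →L[ℝ] ℝ} {κ : ℝ} (hκ : κ ≠ 0) (hlT : ∀ y, l (diffAt 2 f p y) = 0)
    (hl : ∀ y z, l (secondDerivAt 2 f p z y) = κ * β (diffAt 2 f p z) (diffAt 2 f p y))
    (hp : ¬ IsInflection 2 f p) : τ.plane p = orthogonalPlane β f p := by
  obtain ⟨a, b, hli, haa, hab, hbb⟩ := hβ.exists_orthonormal p
  obtain ⟨h1, h2⟩ := hτ.2 p _ _ (isOrthonormalAt_constField haa hab hbb)
  have hAp : constField a p = a := FiberBundle.extend_apply_self _ a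
  have hBp : constField b p = b := FiberBundle.extend_apply_self _ b
  simp only [hAp, hBp, nablaMetric_constField hf hβ.symm,
    secondDerivAt_comm (hf.1.contMDiffAt (x := p)) b a] at h1 h2
  exact plane_eq_orthogonalPlane hβ hf hκ hlT hl hp hli haa hab hbb
    (hτ.1.trace_eq_zero hf hβ.symm hli haa hab hbb) (ε := -3) (by norm_num) (by linarith)
    (by linarith)

end Uniqueness

/-- A hyperquadric in the form used for differentiation. The equation does not vanish identically, as
its degree is two. -/
theorem IsHyperquadric.exists_quadratic {S : Set (RealSpace 4)} (hS : IsHyperquadric S) :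
    ∃ (B : Matrix (Fin 4) (Fin 4) ℝ) (b : Fin 4 → ℝ) (c : ℝ), B.IsSymm ∧
      (∀ x ∈ S, matrixForm B x x / 2 + vectorForm b x + c = 0) ∧
      ∃ x, matrixForm B x x / 2 + vectorForm b x + c ≠ 0 := by
  obtain ⟨F, hF, rfl⟩ := hS
  obtain ⟨B, b, c, hB, h⟩ := F.exists_eval_eq_of_totalDegree_le_two hF.le
  have h' : ∀ x : RealSpace 4, matrixForm B x x / 2 + vectorForm b x + c =
      MvPolynomial.eval (fun i => x i) F := fun x => by
    rw [h, matrixForm_apply, vectorForm_apply]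
  refine ⟨B, b, c, hB, fun x hx => (h' x).trans hx, ?_⟩
  by_contra! h0
  have : F = 0 := MvPolynomial.funext fun x => by
    rw [map_zero, ← h0 (WithLp.toLp 2 x), h']
  rw [this] at hF
  simp at hF

theorem mainTheorem2
    {M : Type*} [TopologicalSpace M] [ChartedSpace (RealSpace 2) M] [IsManifold (𝓡 2) ∞ M]
    {N : Type*} [TopologicalSpace N] [ChartedSpace (RealSpace 3) N] [IsManifold (𝓡 3) ∞ N]
    (S : Set (RealSpace 4)) (hS : IsHyperquadric S)
    (ι : N → RealSpace 4) (hι : IsSmoothImmersion 3 ι) (hιS : ∀ x, ι x ∈ S)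
    (hN : ∀ x, IsLocallyStrictlyConvexAt 3 ι x)
    (j : M → N) (hj : ContMDiff (𝓡 2) (𝓡 3) ∞ j) (hf : IsSmoothImmersion 2 (ι ∘ j)) :
    ∃ σ : TransversalPlaneBundle (ι ∘ j),
      IsAntisymmetricEquiaffine (restrictedBlaschke ι j) σ ∧
      IsSymmetricEquiaffine (restrictedBlaschke ι j) σ ∧
      (∀ τ : TransversalPlaneBundle (ι ∘ j),
        IsAntisymmetricEquiaffine (restrictedBlaschke ι j) τ →
          ∀ p, ¬ IsInflection 2 (ι ∘ j) p → τ.plane p = σ.plane p) ∧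
      (∀ τ : TransversalPlaneBundle (ι ∘ j),
        IsSymmetricEquiaffine (restrictedBlaschke ι j) τ →
          ∀ p, ¬ IsInflection 2 (ι ∘ j) p → τ.plane p = σ.plane p) := by
  obtain ⟨B, b, c, hB, hSB, hF⟩ := hS.exists_quadratic
  have hQ : LiesOnQuadric (matrixForm B) (vectorForm b) c ι :=
    ⟨matrixForm_comm hB, fun x => hSB _ (hιS x)⟩
  have hQf : LiesOnQuadric (matrixForm B) (vectorForm b) c (ι ∘ j) :=
    ⟨matrixForm_comm hB, fun p => hSB _ (hιS (j p))⟩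
  set ρ := fifthRoot (quadricInvariant B b c) with hρ
  let β : RealSpace 4 →L[ℝ] RealSpace 4 →L[ℝ] ℝ := ρ⁻¹ • matrixForm B
  have hβ : ∀ u v, β u v = matrixForm B u v / ρ := fun u v => by
    rw [div_eq_inv_mul]; rfl
  have hd : ∀ p y, diffAt 2 (ι ∘ j) p y = diffAt 3 ι (j p) (mfderiv (𝓡 2) (𝓡 3) j p y) :=
    fun p y => mfderiv_comp_apply p (hι.1.mdifferentiableAt (by simp))
      (hj.mdifferentiableAt (by simp)) y
  have hg : restrictedBlaschke ι j = inducedMetric β (ι ∘ j) := by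
    funext p y z
    rw [restrictedBlaschke, inducedMetric, hQ.blaschkeMetric_eq hB hF hι (hN (j p)), hβ, hd, hd]
  have hpos : IsPositiveOn β (ι ∘ j) := by
    refine ⟨fun u v => by rw [hβ, hβ, matrixForm_comm hB], fun p y hy => ?_⟩
    rw [hβ, hd]
    refine hQ.scaled_hessian_pos hB hF hι (hN (j p)) fun h0 => hy (hf.2 p ?_)
    rw [hd, h0, map_zero, map_zero]
  -- The gradient of the quadric is a conormal of the surface whose second fundamental form is a
  -- multiple of the metric.
  have hl : ∀ p, ∃ (l : RealSpace 4 →L[ℝ] ℝ) (κ : ℝ), κ ≠ 0 ∧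
      (∀ y, l (diffAt 2 (ι ∘ j) p y) = 0) ∧ ∀ y z, l (secondDerivAt 2 (ι ∘ j) p z y) =
        κ * β (diffAt 2 (ι ∘ j) p z) (diffAt 2 (ι ∘ j) p y) := fun p => by
    have hfp := hf.1.contMDiffAt (x := p)
    have hρ0 : ρ ≠ 0 := fun h => by
      obtain ⟨a, _, hli⟩ := exists_linearIndependent_tangentPlane p
      have := hpos.pos p a (hli.ne_zero 0)
      rw [hβ, h, div_zero] at this
      exact this.false
    refine ⟨matrixForm B ((ι ∘ j) p) + vectorForm b, -ρ, neg_ne_zero.2 hρ0,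
      hQf.gradient_diffAt hfp, fun y z => (hQf.gradient_secondDerivAt hfp z y).trans ?_⟩
    rw [hβ]
    field_simp
  rw [hg]
  refine ⟨orthogonalBundle hpos hf, isAntisymmetricEquiaffine_orthogonalBundle hpos hf,
    isSymmetricEquiaffine_orthogonalBundle hpos hf, fun τ hτ p hp => ?_, fun τ hτ p hp => ?_⟩
  · obtain ⟨l, κ, hκ, hlT, hlD⟩ := hl p
    exact hτ.plane_eq hpos hf hκ hlT hlD hp
  · obtain ⟨l, κ, hκ, hlT, hlD⟩ := hl p
    exact hτ.plane_eq hpos hf hκ hlT hlD hp
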